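/- Let $D$ be the open unit disk of $\mathbb{C}$, let $dA$ be the area measure on $D$ normalized so that $A(D)=1$, and put $\varphi_a(z)=(a-z)/(1-\bar a z)$ for $a\in D$. Let $s>0$ and $0<p<\infty$ satisfy $s+p>1$. The space $F(p,p-2,s)$ consists of all analytic functions $f$ on $D$ with $$\|f\|_{F(p,p-2,s)}^p=\sup_{a\in D}\int_D|f'(z)|^p(1-|z|^2)^{p-2}(1-|\varphi_a(z)|^2)^s\,dA(z)<\infty,$$ and we put $|||f|||=|f(0)|+\|f\|_{F(p,p-2,s)}$. For an arc $I$ of the unit circle $\partial D$ let $|I|\in(0,1]$ be its normalized length ($|\partial D|=1$) and let $S(I)=\{z: 1-|I|<|z|<1,\ z/|z|\in I\}$. For a nonnegative Borel measure $\mu$ on $D$, the space $T^\infty_{p,s}(\mu)$ consists of all $\mu$-measurable functions $f$ on $D$ with $$\|f\|_{T^\infty_{p,s}(\mu)}^p=\sup_{I\subset\partial D}|I|^{-s}\int_{S(I)}|f(z)|^p\,d\mu(z)<\infty.$$ The measure $\mu$ is called a $(p,s)$-logarithmic Carleson measure if $\sup_{I\subset\partial D}|I|^{-s}\left(\log\frac{2}{|I|}\right)^p\mu(S(I))<\infty$,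 and a vanishing $(p,s)$-logarithmic Carleson measure if $|I|^{-s}\left(\log\frac{2}{|I|}\right)^p\mu(S(I))\to0$ as $|I|\to0$, uniformly over the arcs $I$. Let $\mu$ be a nonnegative Borel measure on $D$. Then: (i) The embedding $I:F(p,p-2,s)\to T^\infty_{p,s}(\mu)$, $f\mapsto f$, is bounded (that is, it maps into $T^\infty_{p,s}(\mu)$ and $\|f\|_{T^\infty_{p,s}(\mu)}\le C\,|||f|||$ for all $f\in F(p,p-2,s)$ with a constant $C$ independent of $f$) if and only if $\mu$ is a $(p,s)$-logarithmic Carleson measure. (ii) Consider the conditions (a) for every sequence $(f_n)$ in $F(p,p-2,s)$ with $\sup_n|||f_n|||<\infty$ and $f_n\to0$ uniformly on every compact subset of $D$, one has $\lim_{n\to\infty}\|f_n\|_{T^\infty_{p,s}(\mu)}=0$; (b) $\mu$ is a vanishing $(p,s)$-logarithmic Carleson measure. Then (a) implies (b). If $\mu$ is finite on compact subsets of $D$, then (b) implies (a), so that (a) and (b) are equivalent. -/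

import Mathlib

open MeasureTheory Filter Topology Set
open scoped ENNReal NNReal

noncomputable section

/-- The open unit disk `D` of the complex plane. -/
abbrev unitDisk : Set ℂ := Metric.ball (0 : ℂ) 1

/-- The normalized area measure `dA` on the plane, so that `D` has area `1`. -/
def normalizedArea : Measure ℂ := (ENNReal.ofReal Real.pi)⁻¹ • (volume : Measure ℂ)

/-- The Möbius transformation `φ_a(z) = (a - z) / (1 - conj a * z)`. -/
def moebius (a z : ℂ) : ℂ := (a - z) / (1 - (starRingEnd ℂ) a * z)

/-- `‖f‖_{F(p,q,s)}`, with values in `[0,∞]`: the `p`-th root of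
`sup_{a ∈ D} ∫_D |f'(z)|^p (1-|z|^2)^q (1-|φ_a(z)|^2)^s dA(z)`. -/
def seminormF (p q s : ℝ) (f : ℂ → ℂ) : ℝ≥0∞ :=
  (⨆ a ∈ unitDisk, ∫⁻ z in unitDisk,
    ‖deriv f z‖ₑ ^ p *
      ENNReal.ofReal ((1 - ‖z‖ ^ 2) ^ q * (1 - ‖moebius a z‖ ^ 2) ^ s) ∂normalizedArea) ^ (1 / p)

/-- The full norm `|f(0)| + ‖f‖_{F(p,q,s)}`. -/
def normF (p q s : ℝ) (f : ℂ → ℂ) : ℝ≥0∞ := ‖f 0‖ₑ + seminormF p q s f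

/-- The space `F(p,q,s)` of analytic functions on `D`. A function on `D` is represented by a
function on `ℂ`; its values outside `D` play no role. -/
def spaceF (p q s : ℝ) : Set (ℂ → ℂ) :=
  {f | DifferentiableOn ℂ f unitDisk ∧ seminormF p q s f < ∞}

/-- The closed arc of the unit circle with center `exp (iθ)` and normalized length `ℓ ∈ (0,1]`.
The whole circle is the case `ℓ = 1`. All suprema and limits over arcs below are monotone in the
arc for fixed length, so that open and half-open arcs, which lie in the closed arc with the same
center and length, contribute nothing new. -/
def circleArc (θ ℓ : ℝ) : Set ℂ :=
  {ζ | ∃ φ : ℝ, |φ - θ| ≤ Real.pi * ℓ ∧ ζ = Complex.exp (φ * Complex.I)}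

/-- The Carleson box `S(I) = {z : 1 - |I| < |z| < 1, z / |z| ∈ I}` over the arc `I` with center
`exp (iθ)` and normalized length `ℓ`, as a subset of `D`. -/
def carlesonBox (θ ℓ : ℝ) : Set unitDisk :=
  {z | 1 - ℓ < ‖(z : ℂ)‖ ∧ ‖(z : ℂ)‖ < 1 ∧ (z : ℂ) / (‖(z : ℂ)‖ : ℂ) ∈ circleArc θ ℓ}

/-- `‖g‖_{T^∞_{p,s}(μ)}`, with values in `[0,∞]`: the `p`-th root of
`sup_I |I|^{-s} ∫_{S(I)} |g|^p dμ`. -/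
def normT (p s : ℝ) (μ : Measure unitDisk) (g : unitDisk → ℂ) : ℝ≥0∞ :=
  (⨆ (θ : ℝ) (ℓ : ℝ) (_ : ℓ ∈ Ioc (0 : ℝ) 1),
    ENNReal.ofReal (ℓ ^ (-s)) * ∫⁻ z in carlesonBox θ ℓ, ‖g z‖ₑ ^ p ∂μ) ^ (1 / p)

/-- The tent-type space `T^∞_{p,s}(μ)` of `μ`-measurable functions on `D`. -/
def spaceT (p s : ℝ) (μ : Measure unitDisk) : Set (unitDisk → ℂ) :=
  {g | AEMeasurable g μ ∧ normT p s μ g < ∞}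

/-- The embedding `I : f ↦ f`, which regards an analytic function on `D` as a function on `D`. -/
def embedding (f : ℂ → ℂ) : unitDisk → ℂ := fun z => f z

/-- `I : F(p,q,s) → T^∞_{p,s}(μ)` is (well defined and) bounded. -/
def EmbeddingBounded (p q s : ℝ) (μ : Measure unitDisk) : Prop :=
  ∃ C : ℝ≥0, ∀ f ∈ spaceF p q s,
    embedding f ∈ spaceT p s μ ∧ normT p s μ (embedding f) ≤ C * normF p q s f

/-- For every bounded sequence in `F(p,q,s)` that tends to `0` uniformly on every compact subset
of `D`, the norms in `T^∞_{p,s}(μ)` tend to `0`. -/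
def EmbeddingNullSequences (p q s : ℝ) (μ : Measure unitDisk) : Prop :=
  ∀ f : ℕ → ℂ → ℂ, (∀ n, f n ∈ spaceF p q s) →
    (∃ M : ℝ≥0, ∀ n, normF p q s (f n) ≤ M) →
    (∀ K ⊆ unitDisk, IsCompact K → TendstoUniformlyOn f 0 atTop K) →
    Tendsto (fun n => normT p s μ (embedding (f n))) atTop (𝓝 0)

/-- The quantity `|I|^{-s} (log (2/|I|))^p μ(S(I))` for the arc with center `exp (iθ)` and
normalized length `ℓ`. -/
def logCarlesonRatio (p s : ℝ) (μ : Measure unitDisk) (θ ℓ : ℝ) : ℝ≥0∞ :=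
  ENNReal.ofReal (1 / ℓ ^ s * Real.log (2 / ℓ) ^ p) * μ (carlesonBox θ ℓ)

/-- `μ` is a `(p,s)`-logarithmic Carleson measure. -/
def IsLogCarleson (p s : ℝ) (μ : Measure unitDisk) : Prop :=
  ∃ C : ℝ≥0, ∀ θ : ℝ, ∀ ℓ ∈ Ioc (0 : ℝ) 1, logCarlesonRatio p s μ θ ℓ ≤ C

/-- `μ` is a vanishing `(p,s)`-logarithmic Carleson measure: the quantity above tends to `0` as
`|I| → 0`, uniformly in the position of the arc. -/
def IsVanishingLogCarleson (p s : ℝ) (μ : Measure unitDisk) : Prop :=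
  Tendsto (fun ℓ : ℝ => ⨆ θ : ℝ, logCarlesonRatio p s μ θ ℓ) (𝓝[>] 0) (𝓝 0)

end

/-! Necessity rests on test functions. For the arc with center `ζ` and length `ℓ`, put `a = (1 - ℓ)
ζ`. Then `|1 - conj a z| ≤ 6ℓ` on the box, so `log 12 - log (1 - conj a z)` has real part at least
`log (2/ℓ)` there. Its derivative is at most `1 / |1 - conj a z|`, which bounds it in `F(p, p-2, s)`
uniformly in `a` (`exists_lintegral_moebius_weight_le`); this is where `s + p > 1` enters. For the
vanishing version the square of this function divided by `log (2/ℓ)` has the same lower bound and is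
still bounded in the space, but tends to `0` on compact sets as `ℓ → 0`.

Sufficiency rests on a telescoping sum along radii. For `z` in a box of length `ℓ`, compare `f z`
with the value at the point of the same radius at height `2^(-J)`, comparable to `ℓ`. That value is
at most a multiple of `J + 1`, hence of `log (2/ℓ)`, times the norm of `f`, and the Carleson
condition absorbs its `p`-th power. The sub-mean value property of `|f'|^p` bounds the `p`-th power
of the increment at generation `j` by `2^(js)` times the integral of `|f'|^p (1 - |u|^2)^(p-2+s)`
over a disk of radius comparable to `2^(-j)`. Passing the power through the sum costs a factor `(j +
1)^p`. After an exchange of integrals, the `z` whose radius sees a given `u` at generation `j` lie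
in one box of length `O(2^(-j))`, of measure `O(2^(-js) (j + 1)^(-p))`: both factors cancel exactly.
The annuli overlap boundedly, and what remains is the energy of `f` near the arc, which is `O(ℓ^s)`.

The resulting estimate (`exists_setLIntegral_carlesonBox_le`) is linear in the Carleson constant
`c`. A vanishing measure restricted to a thin annulus at the unit circle has small `c`; on the
remaining compact disk the uniform convergence of the sequence and the finiteness of `μ` suffice. -/

/-! ### Elementary estimates for `1 - conj a z` and the Möbius weight -/

theorem norm_one_sub_conj_mul_pos {a z : ℂ} (ha : ‖a‖ ≤ 1) (hz : ‖z‖ < 1) :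
    0 < ‖1 - (starRingEnd ℂ) a * z‖ := by
  have h : ‖(starRingEnd ℂ) a * z‖ < 1 := by
    rw [norm_mul, RCLike.norm_conj]
    nlinarith [norm_nonneg a, norm_nonneg z]
  have := norm_sub_norm_le (1 : ℂ) ((starRingEnd ℂ) a * z)
  rw [norm_one] at this
  linarith

theorem one_sub_norm_le_norm_one_sub_conj_mul {a z : ℂ} (ha : ‖a‖ ≤ 1) :
    1 - ‖z‖ ≤ ‖1 - (starRingEnd ℂ) a * z‖ := by
  have := norm_sub_norm_le (1 : ℂ) ((starRingEnd ℂ) a * z)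
  rw [norm_one, norm_mul, RCLike.norm_conj] at this
  nlinarith [norm_nonneg a, norm_nonneg z]

theorem norm_one_sub_conj_mul_comm (a z : ℂ) :
    ‖1 - (starRingEnd ℂ) a * z‖ = ‖1 - (starRingEnd ℂ) z * a‖ := by
  rw [← RCLike.norm_conj (1 - (starRingEnd ℂ) a * z)]
  simp [mul_comm]

theorem norm_one_sub_conj_mul_le (a z : ℂ) (ha : ‖a‖ ≤ 1) :
    ‖1 - (starRingEnd ℂ) a * z‖ ≤ (1 - ‖a‖ ^ 2) + ‖a - z‖ := by
  have h : 1 - (starRingEnd ℂ) a * z = ((1 - ‖a‖ ^ 2 : ℝ) : ℂ) + (starRingEnd ℂ) a * (a - z) := by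
    push_cast
    rw [← Complex.conj_mul']
    ring
  rw [h]
  refine (norm_add_le _ _).trans ?_
  rw [norm_mul, RCLike.norm_conj, Complex.norm_real, Real.norm_eq_abs, abs_of_nonneg]
  · nlinarith [norm_nonneg (a - z)]
  · nlinarith [norm_nonneg a]

theorem norm_one_sub_conj_mul_sq_sub (a z : ℂ) :
    ‖1 - (starRingEnd ℂ) a * z‖ ^ 2 - ‖a - z‖ ^ 2 = (1 - ‖a‖ ^ 2) * (1 - ‖z‖ ^ 2) := by
  simp only [← Complex.normSq_eq_norm_sq, Complex.normSq_apply]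
  simp
  ring

theorem one_sub_norm_moebius_sq {a z : ℂ} (ha : ‖a‖ ≤ 1) (hz : ‖z‖ < 1) :
    1 - ‖moebius a z‖ ^ 2 =
      (1 - ‖a‖ ^ 2) * (1 - ‖z‖ ^ 2) / ‖1 - (starRingEnd ℂ) a * z‖ ^ 2 := by
  have h := norm_one_sub_conj_mul_pos ha hz
  rw [← norm_one_sub_conj_mul_sq_sub, moebius, norm_div, div_pow, sub_div, div_self (by positivity)]

/-! ### Powers of sums, and the sub-mean value property for every `p > 0` -/

/-- Subadditivity of `x ^ p` for `p ≤ 1`; for `p > 1`, Hölder against the sequence `1 / (j + 1)`,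
whose `q`-th powers are summable. The weight `(j + 1)^p` is exactly what the logarithm in the
Carleson condition can pay for. -/
theorem rpow_sum_le_mul_sum_rpow {p : ℝ} (hp : 0 < p) :
    ∃ C : ℝ≥0, ∀ (t : Finset ℕ) (x : ℕ → ℝ≥0∞),
      (∑ j ∈ t, x j) ^ p ≤ C * ∑ j ∈ t, ((j : ℝ≥0∞) + 1) ^ p * x j ^ p := by
  rcases le_or_gt p 1 with h1 | h1
  · refine ⟨1, fun t x => ?_⟩
    rw [ENNReal.coe_one, one_mul]
    have : (∑ j ∈ t, x j) ^ p ≤ ∑ j ∈ t, x j ^ p := by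
      classical
      induction t using Finset.induction_on with
      | empty => simp [hp]
      | insert a t ha ih =>
        rw [Finset.sum_insert ha, Finset.sum_insert ha]
        exact (ENNReal.rpow_add_le_add_rpow _ _ hp.le h1).trans (by gcongr)
    refine this.trans (Finset.sum_le_sum fun j _ => le_mul_of_one_le_left zero_le ?_)
    exact ENNReal.one_le_rpow (by simp) hp
  · obtain ⟨q, hpq⟩ : ∃ q, p.HolderConjugate q := ⟨_, Real.HolderConjugate.conjExponent h1⟩
    have hq : 1 < q := hpq.symm.lt
    have hsum : Summable fun j : ℕ => (((j : ℝ≥0) + 1)⁻¹) ^ q := by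
      have h0 : Summable fun j : ℕ => ((j : ℝ≥0) ^ q)⁻¹ := NNReal.summable_rpow_inv.2 hq
      have h2 : Summable fun j : ℕ => (((j + 1 : ℕ) : ℝ≥0) ^ q)⁻¹ :=
        NNReal.summable_nat_add _ h0 1
      refine h2.congr fun j => ?_
      rw [NNReal.inv_rpow, Nat.cast_add_one]
    set S : ℝ≥0 := ∑' j : ℕ, (((j : ℝ≥0) + 1)⁻¹) ^ q
    refine ⟨(S ^ (1 / q)) ^ p, fun t x => ?_⟩
    have key := ENNReal.inner_le_Lp_mul_Lq t (fun j => ((j : ℝ≥0∞) + 1) * x j)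
      (fun j => ((((j : ℝ≥0) + 1)⁻¹ : ℝ≥0) : ℝ≥0∞)) hpq
    have e : ∀ j : ℕ, (((j : ℝ≥0∞) + 1) * x j) * ((((j : ℝ≥0) + 1)⁻¹ : ℝ≥0) : ℝ≥0∞) = x j := by
      intro j
      rw [ENNReal.coe_inv (by positivity)]
      push_cast
      rw [mul_right_comm, ENNReal.mul_inv_cancel (by simp) (by simp), one_mul]
    simp only [e] at key
    have hS : ∑ j ∈ t, ((((j : ℝ≥0) + 1)⁻¹ : ℝ≥0) : ℝ≥0∞) ^ q ≤ S := by
      have : ∀ j : ℕ, ((((j : ℝ≥0) + 1)⁻¹ : ℝ≥0) : ℝ≥0∞) ^ q =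
          (((((j : ℝ≥0) + 1)⁻¹) ^ q : ℝ≥0) : ℝ≥0∞) :=
        fun j => (ENNReal.coe_rpow_of_nonneg _ (by linarith)).symm
      simp only [this]
      rw [← ENNReal.ofNNReal_finsetSum]
      exact ENNReal.coe_le_coe.2 (hsum.sum_le_tsum t (fun _ _ => zero_le))
    have hq0 : 0 < q := by linarith
    calc (∑ j ∈ t, x j) ^ p
        ≤ ((∑ j ∈ t, (((j : ℝ≥0∞) + 1) * x j) ^ p) ^ (1 / p) * (S : ℝ≥0∞) ^ (1 / q)) ^ p := by
          gcongr
          exact key.trans (by gcongr)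
      _ = _ := by
          rw [ENNReal.mul_rpow_of_nonneg _ _ hp.le, ← ENNReal.rpow_mul, one_div_mul_cancel hp.ne',
            ENNReal.rpow_one, mul_comm, ENNReal.coe_rpow_of_nonneg _ hp.le,
            ENNReal.coe_rpow_of_nonneg _ (by positivity)]
          congr 1
          exact Finset.sum_congr rfl fun j _ => ENNReal.mul_rpow_of_nonneg _ _ hp.le

/-- A maximum argument replaces subharmonicity. Maximize `(R - |w - c|)^2 |g w|^p`, at `w₀` say.
Around `w₀`, within half its distance to the boundary, `|g|` is at most a constant times `M = |g
w₀|`; the Schwarz lemma then keeps `|g| ≥ M/2` on a disk of comparable radius, and integrating over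
that disk gives the bound. -/
theorem sq_mul_rpow_enorm_le_lintegral {p : ℝ} (hp : 0 < p) :
    ∃ C : ℝ≥0, ∀ (g : ℂ → ℂ) (c : ℂ) (R : ℝ), 0 < R →
      DifferentiableOn ℂ g (Metric.closedBall c R) →
      ENNReal.ofReal (R ^ 2) * ‖g c‖ₑ ^ p ≤ C * ∫⁻ z in Metric.ball c R, ‖g z‖ₑ ^ p := by
  -- With `r` half the distance from `w₀` to the boundary circle, the weight at `w₀` is `4 r^2` and
  -- exceeds `r^2` on the disk of radius `r`, so maximality gives `|g|^p ≤ 4 M^p` there.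
  set K : ℝ := 4 ^ (1 / p) with hK
  have hK0 : 0 < K := by positivity
  refine ⟨(16 * 2 ^ p * (K + 2) ^ 2 / Real.pi).toNNReal, fun g c R hR hg => ?_⟩
  have hpi := Real.pi_pos
  set ψ : ℂ → ℝ := fun w => (R - dist w c) ^ 2 * ‖g w‖ ^ p with hψ
  have hcont : ContinuousOn ψ (Metric.closedBall c R) := by
    refine ContinuousOn.mul (by fun_prop) ?_
    exact (hg.continuousOn.norm).rpow_const (fun _ _ => Or.inr hp.le)
  obtain ⟨w₀, hw₀, hmax⟩ := (isCompact_closedBall c R).exists_isMaxOn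
    ⟨c, Metric.mem_closedBall_self hR.le⟩ hcont
  have hc : R ^ 2 * ‖g c‖ ^ p ≤ ψ w₀ := by
    have := hmax (Metric.mem_closedBall_self hR.le : c ∈ _)
    simpa [hψ] using this
  have hlhs : ENNReal.ofReal (R ^ 2) * ‖g c‖ₑ ^ p = ENNReal.ofReal (R ^ 2 * ‖g c‖ ^ p) := by
    rw [ENNReal.ofReal_mul (by positivity), ← ofReal_norm,
      ENNReal.ofReal_rpow_of_nonneg (norm_nonneg _) hp.le]
  rw [hlhs]
  refine (ENNReal.ofReal_le_ofReal hc).trans ?_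
  rcases eq_or_ne (ψ w₀) 0 with h0 | h0
  · simp [h0]
  have hM : 0 < ‖g w₀‖ := by
    rw [norm_pos_iff]
    rintro h
    exact h0 (by simp [hψ, h, hp.ne'])
  set M := ‖g w₀‖ with hMdef
  have hr' : 0 < R - dist w₀ c := by
    rcases (sub_nonneg.2 (Metric.mem_closedBall.1 hw₀)).lt_or_eq with h | h
    · exact h
    · exact absurd (by simp [hψ, ← h]) h0
  set r := (R - dist w₀ c) / 2 with hr
  have hr0 : 0 < r := by positivity
  have hdist : ∀ w ∈ Metric.ball w₀ r, r < R - dist w c := by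
    intro w hw
    have := dist_triangle w w₀ c
    rw [Metric.mem_ball] at hw
    linarith
  have hsub : Metric.ball w₀ r ⊆ Metric.ball c R := by
    intro w hw
    have := hdist w hw
    rw [Metric.mem_ball]; linarith
  have hbd : ∀ w ∈ Metric.ball w₀ r, ‖g w‖ ≤ K * M := by
    intro w hw
    have h1 := hdist w hw
    have h2 : ψ w ≤ ψ w₀ := hmax (Metric.ball_subset_closedBall (hsub hw))
    have h3 : r ^ 2 * ‖g w‖ ^ p ≤ r ^ 2 * (4 * M ^ p) := by
      calc r ^ 2 * ‖g w‖ ^ p ≤ (R - dist w c) ^ 2 * ‖g w‖ ^ p := by gcongr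
        _ ≤ ψ w₀ := h2
        _ = r ^ 2 * (4 * M ^ p) := by simp only [hψ, hr, ← hMdef]; ring
    have h4 : ‖g w‖ ^ p ≤ (K * M) ^ p := by
      rw [Real.mul_rpow hK0.le hM.le, hK, ← Real.rpow_mul (by norm_num), one_div_mul_cancel hp.ne',
        Real.rpow_one]
      exact le_of_mul_le_mul_left h3 (by positivity)
    exact (Real.rpow_le_rpow_iff (norm_nonneg _) (by positivity) hp).1 h4
  have hmaps : MapsTo g (Metric.ball w₀ r) (Metric.ball (g w₀) ((K + 2) * M)) := by
    intro w hw
    rw [Metric.mem_ball, dist_eq_norm]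
    have := norm_sub_le (g w) (g w₀)
    have := hbd w hw
    nlinarith
  -- Chosen so that the Schwarz bound `(K + 2) M / r * ε` for the variation of `g` equals `M / 2`.
  set ε := r / (2 * (K + 2)) with hε
  have hε0 : 0 < ε := by positivity
  have hεr : ε ≤ r := by
    rw [hε, div_le_iff₀ (by positivity)]
    nlinarith
  have hlow : ∀ w ∈ Metric.ball w₀ ε, M / 2 ≤ ‖g w‖ := by
    intro w hw
    have hw' := Metric.ball_subset_ball hεr hw
    have h := Complex.dist_le_div_mul_dist_of_mapsTo_ball
      (hg.mono (hsub.trans Metric.ball_subset_closedBall))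
      (hmaps.mono_right Metric.ball_subset_closedBall) hw'
    rw [Metric.mem_ball] at hw
    have h2 : (K + 2) * M / r * dist w w₀ ≤ (K + 2) * M / r * ε := by gcongr
    have h3 : (K + 2) * M / r * ε = M / 2 := by
      rw [hε]; field_simp
    have h4 := norm_sub_norm_le (g w₀) (g w)
    rw [← dist_eq_norm, dist_comm] at h4
    linarith
  calc ENNReal.ofReal (ψ w₀)
      = ENNReal.ofReal (16 * 2 ^ p * (K + 2) ^ 2 / Real.pi) *
          (ENNReal.ofReal ((M / 2) ^ p) * volume (Metric.ball w₀ ε)) := by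
        rw [Complex.volume_ball, ← ENNReal.ofReal_coe_nnreal, NNReal.coe_real_pi,
          ← ENNReal.ofReal_pow hε0.le, ← ENNReal.ofReal_mul (by positivity),
          ← ENNReal.ofReal_mul (by positivity), ← ENNReal.ofReal_mul (by positivity)]
        congr 1
        simp only [hψ, hε, ← hMdef]
        rw [show R - dist w₀ c = 2 * r by rw [hr]; ring, Real.div_rpow hM.le (by norm_num)]
        field_simp
        ring
    _ ≤ _ := by
        rw [ENNReal.ofReal]
        gcongr
        calc ENNReal.ofReal ((M / 2) ^ p) * volume (Metric.ball w₀ ε)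
            = ∫⁻ z in Metric.ball w₀ ε, ENNReal.ofReal ((M / 2) ^ p) := by
              rw [setLIntegral_const]
          _ ≤ ∫⁻ z in Metric.ball w₀ ε, ‖g z‖ₑ ^ p := by
              refine setLIntegral_mono' measurableSet_ball fun w hw => ?_
              rw [← ofReal_norm, ENNReal.ofReal_rpow_of_nonneg (norm_nonneg _) hp.le]
              have := hlow w hw
              gcongr
          _ ≤ _ := lintegral_mono_set ((Metric.ball_subset_ball hεr).trans hsub)

/-! ### Uniform weighted area integrals of `|1 - conj a z|^(-p)` -/

/-- The kernel `d ^ g * u ^ (g - 1) * (d + u) ^ (-2 g)` on the half-line `u > 0`. -/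
noncomputable def halfLineKernel (g d : ℝ) : ℝ → ℝ≥0∞ :=
  (Ioi (0 : ℝ)).indicator fun u => ENNReal.ofReal (d ^ g * u ^ (g - 1) * (d + u) ^ (-(2 * g)))

theorem measurable_halfLineKernel (g d : ℝ) : Measurable (halfLineKernel g d) := by
  refine Measurable.indicator ?_ measurableSet_Ioi
  fun_prop

/-- The kernel is scale invariant, so the bound is free of `d`: replacing `d + u` by `d` for `u ≤ d`
and by `u` for `u > d` leaves two power integrals, each equal to `1 / g`. -/
theorem lintegral_halfLineKernel_le {g d : ℝ} (hg : 0 < g) (hd : 0 < d) :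
    ∫⁻ u, halfLineKernel g d u ≤ ENNReal.ofReal (2 / g) := by
  rw [halfLineKernel, lintegral_indicator measurableSet_Ioi, ← Ioc_union_Ioi_eq_Ioi hd.le]
  refine (lintegral_union_le _ _ _).trans ?_
  have h1 : ∫⁻ u in Ioc 0 d, ENNReal.ofReal (d ^ g * u ^ (g - 1) * (d + u) ^ (-(2 * g))) ≤
      ENNReal.ofReal (1 / g) := by
    calc _ ≤ ∫⁻ u in Ioc 0 d, ENNReal.ofReal (d ^ (-g) * u ^ (g - 1)) := by
          refine setLIntegral_mono' measurableSet_Ioc fun u hu => ENNReal.ofReal_le_ofReal ?_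
          have hu0 : 0 < u := hu.1
          have h2 : (d + u) ^ (-(2 * g)) ≤ d ^ (-(2 * g)) :=
            Real.rpow_le_rpow_of_nonpos hd (by linarith) (by linarith)
          calc d ^ g * u ^ (g - 1) * (d + u) ^ (-(2 * g))
              ≤ d ^ g * u ^ (g - 1) * d ^ (-(2 * g)) := by gcongr
            _ = d ^ (g + -(2 * g)) * u ^ (g - 1) := by rw [Real.rpow_add hd]; ring
            _ = _ := by congr 2; ring
      _ = ENNReal.ofReal (∫ u in Ioc 0 d, d ^ (-g) * u ^ (g - 1)) := by
          rw [ofReal_integral_eq_lintegral_ofReal]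
          · refine Integrable.const_mul ?_ _
            exact (intervalIntegral.intervalIntegrable_rpow' (by linarith)).1
          · filter_upwards [self_mem_ae_restrict measurableSet_Ioc] with u hu
            have := hu.1
            positivity
      _ ≤ _ := by
          refine ENNReal.ofReal_le_ofReal (le_of_eq ?_)
          rw [integral_const_mul, ← intervalIntegral.integral_of_le hd.le,
            integral_rpow (Or.inl (by linarith)), sub_add_cancel, Real.zero_rpow hg.ne', sub_zero,
            Real.rpow_neg hd.le]
          have : d ^ g ≠ 0 := by positivity
          field_simp
  have h2 : ∫⁻ u in Ioi d, ENNReal.ofReal (d ^ g * u ^ (g - 1) * (d + u) ^ (-(2 * g))) ≤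
      ENNReal.ofReal (1 / g) := by
    calc _ ≤ ∫⁻ u in Ioi d, ENNReal.ofReal (d ^ g * u ^ (-g - 1)) := by
          refine setLIntegral_mono' measurableSet_Ioi fun u hu => ENNReal.ofReal_le_ofReal ?_
          have hu0 : 0 < u := hd.trans hu
          have h2 : (d + u) ^ (-(2 * g)) ≤ u ^ (-(2 * g)) :=
            Real.rpow_le_rpow_of_nonpos hu0 (by linarith) (by linarith)
          calc d ^ g * u ^ (g - 1) * (d + u) ^ (-(2 * g))
              ≤ d ^ g * u ^ (g - 1) * u ^ (-(2 * g)) := by gcongr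
            _ = d ^ g * u ^ (g - 1 + -(2 * g)) := by rw [Real.rpow_add hu0]; ring
            _ = _ := by congr 2; ring
      _ = ENNReal.ofReal (∫ u in Ioi d, d ^ g * u ^ (-g - 1)) := by
          rw [ofReal_integral_eq_lintegral_ofReal]
          · exact Integrable.const_mul (integrableOn_Ioi_rpow_of_lt (by linarith) hd) _
          · filter_upwards [self_mem_ae_restrict measurableSet_Ioi] with u hu
            have : 0 < u := hd.trans hu
            positivity
      _ ≤ _ := by
          refine ENNReal.ofReal_le_ofReal (le_of_eq ?_)
          rw [integral_const_mul, integral_Ioi_rpow_of_lt (by linarith) hd, sub_add_cancel,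
            Real.rpow_neg hd.le]
          have : d ^ g ≠ 0 := by positivity
          field_simp
  calc _ ≤ ENNReal.ofReal (1 / g) + ENNReal.ofReal (1 / g) := add_le_add h1 h2
    _ = _ := by
      rw [← ENNReal.ofReal_add (by positivity) (by positivity)]
      congr 1; ring

/-- With `t = θ^2 / π^2`, the bound `cos θ ≤ 1 - 2t` makes the squared norm at least `(1 - ρ)^2 +
4ρt`, which is at least `t`; then `π ≤ 4`. -/
theorem abs_div_four_le_norm_one_sub {ρ θ : ℝ} (h0 : 0 ≤ ρ) (hθ : |θ| ≤ Real.pi) :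
    |θ| / 4 ≤ ‖(1 : ℂ) - ρ * (Real.cos θ + Real.sin θ * Complex.I)‖ := by
  have hpi := Real.pi_pos
  refine le_of_sq_le_sq ?_ (norm_nonneg _)
  have h1 : ‖(1 : ℂ) - ρ * (Real.cos θ + Real.sin θ * Complex.I)‖ ^ 2 =
      1 - 2 * ρ * Real.cos θ + ρ ^ 2 := by
    rw [← Complex.normSq_eq_norm_sq, Complex.normSq_apply]
    simp only [Complex.sub_re, Complex.one_re, Complex.mul_re, Complex.ofReal_re, Complex.add_re,
      Complex.ofReal_im, Complex.I_re, Complex.I_im, Complex.sub_im, Complex.one_im,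
      Complex.mul_im, Complex.add_im]
    nlinarith [Real.sin_sq_add_cos_sq θ]
  have h2 := Real.cos_le_one_sub_mul_cos_sq hθ
  set t := θ ^ 2 / Real.pi ^ 2 with ht
  have ht1 : t ≤ 1 := by
    rw [ht, div_le_one (by positivity)]
    exact sq_le_sq' (by linarith [(abs_le.1 hθ).1]) (abs_le.1 hθ).2
  have ht0 : 0 ≤ t := by positivity
  have h3 : 2 / Real.pi ^ 2 * θ ^ 2 = 2 * t := by rw [ht]; ring
  have h4 : (|θ| / 4) ^ 2 ≤ t := by
    rw [div_pow, sq_abs, ht]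
    gcongr
    exact Real.pi_le_four
  rw [h1]
  rw [h3] at h2
  nlinarith [mul_nonneg h0 ht0, mul_nonneg (sq_nonneg (1 - ρ)) (sub_nonneg.2 ht1),
    mul_nonneg (sq_nonneg ρ) ht0]

/-- The model kernel for the weighted area estimates. -/
noncomputable def areaKernel (γ κ d : ℝ) (a z : ℂ) : ℝ :=
  (1 - ‖z‖ ^ 2) ^ (γ - 1) * ‖1 - (starRingEnd ℂ) a * z‖ ^ (-(1 - κ)) * d ^ (γ + κ) *
    (d + ‖1 - (starRingEnd ℂ) a * z‖) ^ (-(2 * (γ + κ)))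

/-- Since `|1 - conj a z|` dominates both `1 - r` and `|θ| / 4`, the negative powers can be shared
between the two variables. The kernel splits into a product of half-line kernels, with exponent `γ`
in `1 - r` and `κ` in `|θ|`. -/
theorem areaKernel_polar_le {γ κ d ρ r θ : ℝ} (hγ : 0 < γ) (hκ : 0 < κ) (hκ1 : κ ≤ 1) (hd : 0 < d)
    (hρ0 : 0 ≤ ρ) (hρ1 : ρ ≤ 1) (hr0 : 0 < r) (hr1 : r < 1) (hθ0 : θ ≠ 0) (hθ : |θ| ≤ Real.pi) :
    areaKernel γ κ d ρ (r * (Real.cos θ + Real.sin θ * Complex.I)) ≤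
      2 ^ |γ - 1| * 4 ^ (1 - κ) * 4 ^ (2 * κ) *
        ((d ^ γ * (1 - r) ^ (γ - 1) * (d + (1 - r)) ^ (-(2 * γ))) *
          (d ^ κ * |θ| ^ (κ - 1) * (d + |θ|) ^ (-(2 * κ)))) := by
  have hz : ‖(r : ℂ) * (Real.cos θ + Real.sin θ * Complex.I)‖ = r := by
    have := Complex.norm_polarCoord_symm (r, θ)
    rw [Complex.polarCoord_symm_apply] at this
    rw [this, abs_of_pos hr0]
  set z : ℂ := (r : ℂ) * (Real.cos θ + Real.sin θ * Complex.I) with hzdef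
  set x := ‖1 - (starRingEnd ℂ) (ρ : ℂ) * z‖ with hx
  have hu : 0 < 1 - r := by linarith
  have hxu : 1 - r ≤ x := by
    have := one_sub_norm_le_norm_one_sub_conj_mul (a := ρ) (z := z)
      (by rwa [Complex.norm_real, Real.norm_of_nonneg hρ0])
    rwa [hz] at this
  have hxθ : |θ| / 4 ≤ x := by
    have := abs_div_four_le_norm_one_sub (ρ := ρ * r) (by positivity) hθ
    rw [hx, hzdef, Complex.conj_ofReal, ← mul_assoc, ← Complex.ofReal_mul]
    exact this
  have hθp : 0 < |θ| := abs_pos.2 hθ0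
  have hx0 : 0 < x := hu.trans_le hxu
  have e1 : (1 - r ^ 2) ^ (γ - 1) ≤ 2 ^ |γ - 1| * (1 - r) ^ (γ - 1) := by
    rw [show 1 - r ^ 2 = (1 + r) * (1 - r) by ring, Real.mul_rpow (by linarith) hu.le]
    gcongr
    calc (1 + r) ^ (γ - 1) ≤ (1 + r) ^ |γ - 1| :=
          Real.rpow_le_rpow_of_exponent_le (by linarith) (le_abs_self _)
      _ ≤ 2 ^ |γ - 1| := by gcongr; linarith
  have e2 : x ^ (-(1 - κ)) ≤ 4 ^ (1 - κ) * |θ| ^ (κ - 1) := by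
    calc x ^ (-(1 - κ)) ≤ (|θ| / 4) ^ (-(1 - κ)) :=
          Real.rpow_le_rpow_of_nonpos (by positivity) hxθ (by linarith)
      _ = _ := by
        rw [Real.div_rpow hθp.le (by norm_num), Real.rpow_neg (by norm_num : (0 : ℝ) ≤ 4),
          div_inv_eq_mul, mul_comm, neg_sub]
  have e3 : (d + x) ^ (-(2 * (γ + κ))) ≤
      (d + (1 - r)) ^ (-(2 * γ)) * (4 ^ (2 * κ) * (d + |θ|) ^ (-(2 * κ))) := by
    rw [show -(2 * (γ + κ)) = -(2 * γ) + -(2 * κ) by ring, Real.rpow_add (by positivity)]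
    gcongr ?_ * ?_
    · exact Real.rpow_le_rpow_of_nonpos (by positivity) (by linarith) (by linarith)
    · calc (d + x) ^ (-(2 * κ)) ≤ ((d + |θ|) / 4) ^ (-(2 * κ)) :=
          Real.rpow_le_rpow_of_nonpos (by positivity) (by linarith) (by linarith)
        _ = _ := by
          rw [Real.div_rpow (by positivity) (by norm_num),
            Real.rpow_neg (by norm_num : (0 : ℝ) ≤ 4), div_inv_eq_mul, mul_comm]
  calc areaKernel γ κ d ρ z
      = (1 - r ^ 2) ^ (γ - 1) * x ^ (-(1 - κ)) * d ^ (γ + κ) * (d + x) ^ (-(2 * (γ + κ))) := by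
        rw [areaKernel, hz]
    _ ≤ (2 ^ |γ - 1| * (1 - r) ^ (γ - 1)) * (4 ^ (1 - κ) * |θ| ^ (κ - 1)) * d ^ (γ + κ) *
          ((d + (1 - r)) ^ (-(2 * γ)) * (4 ^ (2 * κ) * (d + |θ|) ^ (-(2 * κ)))) := by
        gcongr
    _ = _ := by
        rw [Real.rpow_add hd]
        ring

theorem lintegral_areaKernel_real_le {γ κ : ℝ} (hγ : 0 < γ) (hκ : 0 < κ) (hκ1 : κ ≤ 1) {d ρ : ℝ}
    (hd : 0 < d) (hρ0 : 0 ≤ ρ) (hρ1 : ρ ≤ 1) :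
    ∫⁻ z in unitDisk, ENNReal.ofReal (areaKernel γ κ d ρ z) ≤
      ENNReal.ofReal (2 ^ |γ - 1| * 4 ^ (1 - κ) * 4 ^ (2 * κ)) *
        (ENNReal.ofReal (2 / γ) * (2 * ENNReal.ofReal (2 / κ))) := by
  set A : ℝ := 2 ^ |γ - 1| * 4 ^ (1 - κ) * 4 ^ (2 * κ) with hA
  have hA0 : 0 ≤ A := by positivity
  set K₁ : ℝ → ℝ≥0∞ := fun r => halfLineKernel γ d (1 - r) with hK₁
  set K₂ : ℝ → ℝ≥0∞ := fun θ => halfLineKernel κ d θ + halfLineKernel κ d (-θ) with hK₂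
  have m₁ : Measurable K₁ := (measurable_halfLineKernel γ d).comp (by fun_prop)
  have m₂ : Measurable K₂ := (measurable_halfLineKernel κ d).add
    ((measurable_halfLineKernel κ d).comp (by fun_prop))
  have hae : ∀ᵐ p : ℝ × ℝ, p.2 ≠ 0 := by
    rw [ae_iff]
    have : {p : ℝ × ℝ | ¬p.2 ≠ 0} = univ ×ˢ {0} := by ext; simp
    rw [this, Measure.volume_eq_prod, Measure.prod_prod]
    simp
  rw [← lintegral_indicator measurableSet_ball, ← Complex.lintegral_comp_polarCoord_symm]
  calc _ ≤ ∫⁻ p in polarCoord.target, ENNReal.ofReal A * (K₁ p.1 * K₂ p.2) := by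
        refine setLIntegral_mono_ae' polarCoord.open_target.measurableSet ?_
        filter_upwards [hae] with p hp0 hp
        obtain ⟨hr, hθ⟩ : 0 < p.1 ∧ (-Real.pi < p.2 ∧ p.2 < Real.pi) := by
          simpa [polarCoord] using hp
        by_cases h1 : p.1 < 1
        · rw [indicator_of_mem]
          swap
          · rw [Metric.mem_ball, dist_zero_right, Complex.norm_polarCoord_symm, abs_of_pos hr]
            exact h1
          have hθ' : |p.2| ≤ Real.pi := abs_le.2 ⟨hθ.1.le, hθ.2.le⟩
          have h := areaKernel_polar_le hγ hκ hκ1 hd hρ0 hρ1 hr h1 hp0 hθ'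
          have hk₁ : K₁ p.1 =
              ENNReal.ofReal (d ^ γ * (1 - p.1) ^ (γ - 1) * (d + (1 - p.1)) ^ (-(2 * γ))) := by
            simp only [hK₁, halfLineKernel]
            rw [indicator_of_mem (by simpa using h1)]
          have hk₂ : ENNReal.ofReal (d ^ κ * |p.2| ^ (κ - 1) * (d + |p.2|) ^ (-(2 * κ))) ≤
              K₂ p.2 := by
            simp only [hK₂, halfLineKernel]
            rcases lt_or_gt_of_ne hp0 with hneg | hpos
            · rw [abs_of_neg hneg]
              refine le_add_left ?_
              rw [indicator_of_mem (by simpa using hneg)]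
            · rw [abs_of_pos hpos]
              refine le_add_right ?_
              rw [indicator_of_mem (by simpa using hpos)]
          calc ENNReal.ofReal p.1 • ENNReal.ofReal (areaKernel γ κ d ρ (Complex.polarCoord.symm p))
              ≤ 1 * ENNReal.ofReal (areaKernel γ κ d ρ (Complex.polarCoord.symm p)) := by
                rw [smul_eq_mul]
                gcongr
                exact ENNReal.ofReal_le_one.2 h1.le
            _ ≤ ENNReal.ofReal (A *
                  ((d ^ γ * (1 - p.1) ^ (γ - 1) * (d + (1 - p.1)) ^ (-(2 * γ))) *
                  (d ^ κ * |p.2| ^ (κ - 1) * (d + |p.2|) ^ (-(2 * κ))))) := by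
                rw [one_mul, Complex.polarCoord_symm_apply]
                exact ENNReal.ofReal_le_ofReal h
            _ ≤ _ := by
                have : 0 < 1 - p.1 := by linarith
                rw [ENNReal.ofReal_mul hA0, ENNReal.ofReal_mul
                  (p := d ^ γ * (1 - p.1) ^ (γ - 1) * (d + (1 - p.1)) ^ (-(2 * γ)))
                  (by positivity), hk₁]
                exact mul_le_mul_right (mul_le_mul_right hk₂ _) _
        · rw [indicator_of_notMem]
          · simp
          · rw [Metric.mem_ball, dist_zero_right, Complex.norm_polarCoord_symm, abs_of_pos hr]
            exact h1
    _ ≤ ∫⁻ p : ℝ × ℝ, ENNReal.ofReal A * (K₁ p.1 * K₂ p.2) := setLIntegral_le_lintegral _ _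
    _ = ENNReal.ofReal A * ((∫⁻ r, K₁ r) * ∫⁻ θ, K₂ θ) := by
        rw [lintegral_const_mul _ (by fun_prop), Measure.volume_eq_prod,
          lintegral_prod_mul m₁.aemeasurable m₂.aemeasurable]
    _ ≤ _ := by
        have i₁ : ∫⁻ r, K₁ r ≤ ENNReal.ofReal (2 / γ) := by
          rw [hK₁, lintegral_sub_left_eq_self (halfLineKernel γ d) 1]
          exact lintegral_halfLineKernel_le hγ hd
        have i₂ : ∫⁻ θ, K₂ θ ≤ 2 * ENNReal.ofReal (2 / κ) := by
          rw [hK₂, lintegral_add_left (measurable_halfLineKernel κ d),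
            lintegral_neg_eq_self (halfLineKernel κ d), ← two_mul]
          gcongr
          exact lintegral_halfLineKernel_le hκ hd
        gcongr

theorem measurable_areaKernel (γ κ d : ℝ) (a : ℂ) : Measurable (areaKernel γ κ d a) := by
  unfold areaKernel
  fun_prop

theorem exists_lintegral_areaKernel_le {γ κ : ℝ} (hγ : 0 < γ) (hκ : 0 < κ) (hκ1 : κ ≤ 1) :
    ∃ C : ℝ≥0, ∀ a ∈ unitDisk, ∀ d : ℝ, 0 < d →
      ∫⁻ z in unitDisk, ENNReal.ofReal (areaKernel γ κ d a z) ≤ C := by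
  have hfin : ENNReal.ofReal (2 ^ |γ - 1| * 4 ^ (1 - κ) * 4 ^ (2 * κ)) *
        (ENNReal.ofReal (2 / γ) * (2 * ENNReal.ofReal (2 / κ))) ≠ ∞ := by finiteness
  refine ⟨(ENNReal.ofReal (2 ^ |γ - 1| * 4 ^ (1 - κ) * 4 ^ (2 * κ)) *
        (ENNReal.ofReal (2 / γ) * (2 * ENNReal.ofReal (2 / κ)))).toNNReal, fun a ha d hd => ?_⟩
  · rw [ENNReal.coe_toNNReal hfin]
    have ha1 : ‖a‖ ≤ 1 := by simpa using (mem_ball_zero_iff.1 ha).le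
    have key := lintegral_areaKernel_real_le hγ hκ hκ1 hd (norm_nonneg a) ha1
    refine le_trans (le_of_eq ?_) key
    -- Rotation invariance of area reduces to `a = |a|`.
    set R := rotation (Circle.exp (-Complex.arg a))
    have hpre : R ⁻¹' unitDisk = unitDisk := by
      ext z; simp
    have hR := (R.measurePreserving.setLIntegral_comp_preimage (measurableSet_ball (x := 0) (ε := 1))
      (f := fun z => ENNReal.ofReal (areaKernel γ κ d (‖a‖ : ℂ) z))
      (measurable_areaKernel γ κ d _).ennreal_ofReal)
    rw [← hR, show R ⁻¹' Metric.ball 0 1 = unitDisk from hpre]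
    refine lintegral_congr fun z => ?_
    have h1 : (starRingEnd ℂ) (‖a‖ : ℂ) * R z = (starRingEnd ℂ) a * z := by
      have h2 : a = ‖a‖ * Complex.exp (a.arg * Complex.I) := (Complex.norm_mul_exp_arg_mul_I a).symm
      have h3 : R z = Complex.exp (-a.arg * Complex.I) * z := by
        change (Circle.exp (-a.arg) : ℂ) * z = _
        rw [Circle.coe_exp]
        push_cast
        rfl
      rw [h3]
      conv_rhs => rw [h2]
      rw [map_mul, ← Complex.exp_conj, map_mul, Complex.conj_I, Complex.conj_ofReal,
        Complex.conj_ofReal, ← mul_assoc]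
      congr 3
      ring
    simp only [areaKernel, h1, LinearIsometryEquiv.norm_map]

/-- Write `x = |1 - conj a z|`, `y = |1 - conj b z|`, `d = |1 - conj a b|`, `h = 1 - |b|^2`. As `1 -
|z|^2 ≤ 2x`, the power `x^(-p)` may be lowered to `x^(-q)`. If `y ≤ x`, replace `x` by `y` and use
`h + y ≤ 3y`: this is the kernel at `b` with scale `h`. If `x < y`, then `d ≤ x + y` gives `d + x ≤
3y`, and `h ≤ 2d`: this is the kernel at `a` with scale `d`. -/
theorem moebius_weight_le {p s q : ℝ} (hs : 0 < s) (hq0 : 0 ≤ q) (hqp : q ≤ p)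
    {a b z : ℂ} (ha : a ∈ unitDisk) (hb : b ∈ unitDisk) (hz : z ∈ unitDisk) :
    (1 - ‖z‖ ^ 2) ^ (p - 2) * (1 - ‖moebius b z‖ ^ 2) ^ s *
        ‖1 - (starRingEnd ℂ) a * z‖ ^ (-p) ≤
      2 ^ (p - q) * 3 ^ (2 * s) * 2 ^ s *
        (areaKernel (s - 1 + q) (1 - q) (1 - ‖b‖ ^ 2) b z +
          areaKernel (s - 1 + q) (1 - q) ‖1 - (starRingEnd ℂ) a * b‖ a z) := by
  rw [mem_ball_zero_iff] at ha hb hz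
  rw [one_sub_norm_moebius_sq hb.le hz]
  have hx0 := norm_one_sub_conj_mul_pos ha.le hz
  have hy0 := norm_one_sub_conj_mul_pos hb.le hz
  have hd0 := norm_one_sub_conj_mul_pos ha.le hb
  have hvx := one_sub_norm_le_norm_one_sub_conj_mul (z := z) ha.le
  have hvy := one_sub_norm_le_norm_one_sub_conj_mul (z := z) hb.le
  have hhy : 1 - ‖b‖ ≤ ‖1 - (starRingEnd ℂ) b * z‖ := by
    rw [norm_one_sub_conj_mul_comm]
    exact one_sub_norm_le_norm_one_sub_conj_mul hz.le
  have hhd : 1 - ‖b‖ ≤ ‖1 - (starRingEnd ℂ) a * b‖ :=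
    one_sub_norm_le_norm_one_sub_conj_mul ha.le
  have hv0 : 0 < 1 - ‖z‖ ^ 2 := by nlinarith [norm_nonneg z]
  have hh0 : 0 < 1 - ‖b‖ ^ 2 := by nlinarith [norm_nonneg b]
  have hdxy : ‖1 - (starRingEnd ℂ) a * b‖ ≤
      ‖1 - (starRingEnd ℂ) a * z‖ + ‖1 - (starRingEnd ℂ) b * z‖ := by
    have e : 1 - (starRingEnd ℂ) a * b =
        (1 - (starRingEnd ℂ) a * z) + (starRingEnd ℂ) a * (z - b) := by ring
    have h1 : ‖z - b‖ ≤ ‖1 - (starRingEnd ℂ) b * z‖ := by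
      refine le_of_sq_le_sq ?_ (norm_nonneg _)
      have := norm_one_sub_conj_mul_sq_sub b z
      rw [norm_sub_rev]
      nlinarith [mul_pos hh0 hv0]
    rw [e]
    refine (norm_add_le _ _).trans ?_
    rw [norm_mul, RCLike.norm_conj]
    nlinarith [norm_nonneg (z - b), norm_nonneg a]
  have hvx' : 1 - ‖z‖ ^ 2 ≤ 2 * ‖1 - (starRingEnd ℂ) a * z‖ := by nlinarith [norm_nonneg z]
  have hhy' : 1 - ‖b‖ ^ 2 ≤ 2 * ‖1 - (starRingEnd ℂ) b * z‖ := by nlinarith [norm_nonneg b]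
  have hhd' : 1 - ‖b‖ ^ 2 ≤ 2 * ‖1 - (starRingEnd ℂ) a * b‖ := by nlinarith [norm_nonneg b]
  unfold areaKernel
  set x := ‖1 - (starRingEnd ℂ) a * z‖
  set y := ‖1 - (starRingEnd ℂ) b * z‖
  set d := ‖1 - (starRingEnd ℂ) a * b‖
  set v := 1 - ‖z‖ ^ 2
  set h := 1 - ‖b‖ ^ 2
  rw [show s - 1 + q + (1 - q) = s by ring, show s - 1 + q - 1 = s - 2 + q by ring,
    show -(1 - (1 - q)) = -q by ring]
  have e0 : v ^ (p - 2) * (h * v / y ^ 2) ^ s * x ^ (-p) ≤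
      2 ^ (p - q) * (v ^ (s - 2 + q) * x ^ (-q) * h ^ s * y ^ (-(2 * s))) := by
    have e1 : v ^ (p - q) ≤ 2 ^ (p - q) * x ^ (p - q) := by
      rw [← Real.mul_rpow (by norm_num) hx0.le]
      gcongr
    have e2 : v ^ (p - 2) * v ^ s = v ^ (s - 2 + q) * v ^ (p - q) := by
      rw [← Real.rpow_add hv0, ← Real.rpow_add hv0]; congr 1; ring
    have e3 : x ^ (-p) * x ^ (p - q) = x ^ (-q) := by
      rw [← Real.rpow_add hx0]; congr 1; ring
    have e4 : (y ^ 2) ^ s = y ^ (2 * s) := by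
      rw [← Real.rpow_natCast, ← Real.rpow_mul hy0.le]; norm_num
    rw [Real.div_rpow (by positivity) (by positivity), Real.mul_rpow hh0.le hv0.le, e4,
      Real.rpow_neg hy0.le]
    calc v ^ (p - 2) * (h ^ s * v ^ s / y ^ (2 * s)) * x ^ (-p)
        = (v ^ (p - 2) * v ^ s) * h ^ s * (y ^ (2 * s))⁻¹ * x ^ (-p) := by ring
      _ = v ^ (s - 2 + q) * v ^ (p - q) * h ^ s * (y ^ (2 * s))⁻¹ * x ^ (-p) := by rw [e2]
      _ ≤ v ^ (s - 2 + q) * (2 ^ (p - q) * x ^ (p - q)) * h ^ s * (y ^ (2 * s))⁻¹ * x ^ (-p) := by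
          gcongr
      _ = 2 ^ (p - q) *
          (v ^ (s - 2 + q) * (x ^ (-p) * x ^ (p - q)) * h ^ s * (y ^ (2 * s))⁻¹) := by ring
      _ = _ := by rw [e3]
  have ypow : ∀ w : ℝ, 0 < w → w ≤ 3 * y → y ^ (-(2 * s)) ≤ 3 ^ (2 * s) * w ^ (-(2 * s)) := by
    intro w hw hwy
    calc y ^ (-(2 * s)) ≤ (w / 3) ^ (-(2 * s)) :=
          Real.rpow_le_rpow_of_nonpos (by positivity) (by linarith) (by linarith)
      _ = _ := by
          rw [Real.div_rpow hw.le (by norm_num), Real.rpow_neg (by norm_num : (0 : ℝ) ≤ 3),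
            div_inv_eq_mul, mul_comm]
  refine e0.trans ?_
  rw [mul_assoc (2 ^ (p - q) : ℝ), mul_assoc (2 ^ (p - q) : ℝ)]
  refine mul_le_mul_of_nonneg_left ?_ (by positivity)
  rw [mul_assoc (3 ^ (2 * s) : ℝ)]
  have n1 : 0 ≤ v ^ (s - 2 + q) * y ^ (-q) * h ^ s * (h + y) ^ (-(2 * s)) := by positivity
  have n2 : 0 ≤ v ^ (s - 2 + q) * x ^ (-q) * d ^ s * (d + x) ^ (-(2 * s)) := by positivity
  have one_le : (1 : ℝ) ≤ 2 ^ s := Real.one_le_rpow (by norm_num) hs.le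
  rcases le_or_gt y x with hyx | hxy
  · have e1 : x ^ (-q) ≤ y ^ (-q) := Real.rpow_le_rpow_of_nonpos hy0 hyx (by linarith)
    have e2 := ypow (h + y) (by positivity) (by linarith)
    calc v ^ (s - 2 + q) * x ^ (-q) * h ^ s * y ^ (-(2 * s))
        ≤ v ^ (s - 2 + q) * y ^ (-q) * h ^ s * (3 ^ (2 * s) * (h + y) ^ (-(2 * s))) := by gcongr
      _ = 3 ^ (2 * s) * (1 * (v ^ (s - 2 + q) * y ^ (-q) * h ^ s * (h + y) ^ (-(2 * s)))) := by
          ring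
      _ ≤ _ := by gcongr; linarith
  · have e1 : h ^ s ≤ 2 ^ s * d ^ s := by
      rw [← Real.mul_rpow (by norm_num) hd0.le]
      gcongr
    have e2 := ypow (d + x) (by positivity) (by linarith)
    calc v ^ (s - 2 + q) * x ^ (-q) * h ^ s * y ^ (-(2 * s))
        ≤ v ^ (s - 2 + q) * x ^ (-q) * (2 ^ s * d ^ s) *
            (3 ^ (2 * s) * (d + x) ^ (-(2 * s))) := by gcongr
      _ = 3 ^ (2 * s) * (2 ^ s * (v ^ (s - 2 + q) * x ^ (-q) * d ^ s * (d + x) ^ (-(2 * s)))) := by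
          ring
      _ ≤ _ := by gcongr; linarith

/-- Uniform boundedness in `F(p, p - 2, s)` of functions whose derivative is dominated by
`1 / |1 - conj a z|`. -/
theorem exists_lintegral_moebius_weight_le {p s : ℝ} (hs : 0 < s) (hp : 0 < p) (hsp : 1 < s + p) :
    ∃ C : ℝ≥0, ∀ a ∈ unitDisk, ∀ b ∈ unitDisk,
      ∫⁻ z in unitDisk, ENNReal.ofReal ((1 - ‖z‖ ^ 2) ^ (p - 2) *
        (1 - ‖moebius b z‖ ^ 2) ^ s * ‖1 - (starRingEnd ℂ) a * z‖ ^ (-p)) ≤ C := by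
  -- The kernel exponents `γ = s - 1 + q` and `κ = 1 - q` must be positive and `q ≤ p`; the interval
  -- for `q` is nonempty because `s + p > 1`.
  obtain ⟨q, hq1, hq2⟩ : ∃ q, max 0 (1 - s) < q ∧ q < min p 1 :=
    exists_between (by rw [max_lt_iff, lt_min_iff, lt_min_iff]; constructor <;> constructor <;> linarith)
  rw [max_lt_iff] at hq1
  rw [lt_min_iff] at hq2
  obtain ⟨C, hC⟩ := exists_lintegral_areaKernel_le (γ := s - 1 + q) (κ := 1 - q) (by linarith)
    (by linarith) (by linarith)
  set A : ℝ := 2 ^ (p - q) * 3 ^ (2 * s) * 2 ^ s with hA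
  have hA0 : 0 ≤ A := by positivity
  refine ⟨A.toNNReal * (C + C), fun a ha b hb => ?_⟩
  have ha' := mem_ball_zero_iff.1 ha
  have hb' := mem_ball_zero_iff.1 hb
  have hd : 0 < ‖1 - (starRingEnd ℂ) a * b‖ := norm_one_sub_conj_mul_pos ha'.le hb'
  have hh : 0 < 1 - ‖b‖ ^ 2 := by nlinarith [norm_nonneg b]
  calc _ ≤ ∫⁻ z in unitDisk, ENNReal.ofReal A *
        (ENNReal.ofReal (areaKernel (s - 1 + q) (1 - q) (1 - ‖b‖ ^ 2) b z) +
          ENNReal.ofReal (areaKernel (s - 1 + q) (1 - q) ‖1 - (starRingEnd ℂ) a * b‖ a z)) := by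
        refine setLIntegral_mono' measurableSet_ball fun z hz => ?_
        refine (ENNReal.ofReal_le_ofReal
          (moebius_weight_le hs hq1.1.le hq2.1.le ha hb hz)).trans ?_
        rw [ENNReal.ofReal_mul hA0]
        gcongr
        exact ENNReal.ofReal_add_le
    _ ≤ ENNReal.ofReal A * (C + C) := by
        have m := fun d a => (measurable_areaKernel (s - 1 + q) (1 - q) d a).ennreal_ofReal
        rw [lintegral_const_mul' _ _ ENNReal.ofReal_ne_top, lintegral_add_left (m _ _)]
        gcongr
        · exact hC b hb _ hh
        · exact hC a ha _ hd
    _ = _ := by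
        rw [ENNReal.ofReal]; push_cast; rfl

/-! ### Local energy of `f'` controlled by the seminorm -/

/-- The density `|f'|^p (1 - |u|^2)^(p-2+s)`. -/
noncomputable def energyDensity (p s : ℝ) (f : ℂ → ℂ) (u : ℂ) : ℝ≥0∞ :=
  ‖deriv f u‖ₑ ^ p * ENNReal.ofReal ((1 - ‖u‖ ^ 2) ^ (p - 2 + s))

theorem measurable_energyDensity (p s : ℝ) (f : ℂ → ℂ) : Measurable (energyDensity p s f) := by
  have := measurable_deriv f
  unfold energyDensity
  fun_prop

theorem lintegral_normalizedArea (S : Set ℂ) (g : ℂ → ℝ≥0∞) :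
    ∫⁻ z in S, g z ∂normalizedArea = (ENNReal.ofReal Real.pi)⁻¹ * ∫⁻ z in S, g z := by
  rw [normalizedArea, Measure.restrict_smul, lintegral_smul_measure, smul_eq_mul]

theorem seminormF_rpow {p : ℝ} (hp : 0 < p) (q s : ℝ) (f : ℂ → ℂ) :
    seminormF p q s f ^ p = ⨆ a ∈ unitDisk, (ENNReal.ofReal Real.pi)⁻¹ * ∫⁻ z in unitDisk,
      ‖deriv f z‖ₑ ^ p *
        ENNReal.ofReal ((1 - ‖z‖ ^ 2) ^ q * (1 - ‖moebius a z‖ ^ 2) ^ s) := by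
  rw [seminormF, ← ENNReal.rpow_mul, one_div_mul_cancel hp.ne', ENNReal.rpow_one]
  simp only [lintegral_normalizedArea]

theorem lintegral_le_seminormF {p : ℝ} (hp : 0 < p) (q s : ℝ) (f : ℂ → ℂ) {a : ℂ}
    (ha : a ∈ unitDisk) :
    ∫⁻ z in unitDisk, ‖deriv f z‖ₑ ^ p *
        ENNReal.ofReal ((1 - ‖z‖ ^ 2) ^ q * (1 - ‖moebius a z‖ ^ 2) ^ s) ≤
      ENNReal.ofReal Real.pi * seminormF p q s f ^ p := by
  have hpi : ENNReal.ofReal Real.pi ≠ 0 := by simpa using Real.pi_pos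
  rw [seminormF_rpow hp, ← ENNReal.inv_mul_le_iff hpi ENNReal.ofReal_ne_top]
  exact le_iSup₂ (f := fun a (_ : a ∈ unitDisk) => (ENNReal.ofReal Real.pi)⁻¹ *
    ∫⁻ z in unitDisk, ‖deriv f z‖ₑ ^ p *
        ENNReal.ofReal ((1 - ‖z‖ ^ 2) ^ q * (1 - ‖moebius a z‖ ^ 2) ^ s)) a ha

/-- On `S` the hypothesis gives `1 - |u|^2 ≤ M^2 (1 - |a|^2) (1 - |φ_a(u)|^2)`, so the energy on `S`
is read off from the seminorm integral at the single point `a`. -/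
theorem setLIntegral_energyDensity_le {p s : ℝ} (hp : 0 < p) (hs : 0 < s) (f : ℂ → ℂ) {a : ℂ}
    (ha : a ∈ unitDisk) {M : ℝ} {S : Set ℂ} (hSm : MeasurableSet S) (hS : S ⊆ unitDisk)
    (hM : ∀ u ∈ S, ‖1 - (starRingEnd ℂ) a * u‖ ≤ M * (1 - ‖a‖ ^ 2)) :
    ∫⁻ u in S, energyDensity p s f u ≤
      ENNReal.ofReal (Real.pi * M ^ (2 * s) * (1 - ‖a‖ ^ 2) ^ s) *
        seminormF p (p - 2) s f ^ p := by
  have ha' := mem_ball_zero_iff.1 ha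
  have hh : 0 < 1 - ‖a‖ ^ 2 := by nlinarith [norm_nonneg a]
  rcases S.eq_empty_or_nonempty with rfl | ⟨u₀, hu₀⟩
  · simp
  have hM0 : 0 < M := by
    have h1 := norm_one_sub_conj_mul_pos ha'.le (mem_ball_zero_iff.1 (hS hu₀))
    have h2 := hM u₀ hu₀
    by_contra hneg
    nlinarith
  set A : ℝ := M ^ (2 * s) * (1 - ‖a‖ ^ 2) ^ s with hA
  have hA0 : 0 ≤ A := by positivity
  calc ∫⁻ u in S, energyDensity p s f u
      ≤ ∫⁻ u in S, ENNReal.ofReal A * (‖deriv f u‖ₑ ^ p *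
        ENNReal.ofReal ((1 - ‖u‖ ^ 2) ^ (p - 2) * (1 - ‖moebius a u‖ ^ 2) ^ s)) := by
        refine setLIntegral_mono' hSm fun u hu => ?_
        have hu' := mem_ball_zero_iff.1 (hS hu)
        have hv : 0 < 1 - ‖u‖ ^ 2 := by nlinarith [norm_nonneg u]
        have hy := norm_one_sub_conj_mul_pos ha'.le hu'
        have hyM := hM u hu
        rw [energyDensity, mul_left_comm, ← ENNReal.ofReal_mul hA0]
        gcongr
        rw [one_sub_norm_moebius_sq ha'.le hu']
        set y := ‖1 - (starRingEnd ℂ) a * u‖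
        set v := 1 - ‖u‖ ^ 2
        set h := 1 - ‖a‖ ^ 2
        have e1 : v ≤ M ^ 2 * h * (h * v / y ^ 2) := by
          have : y ^ 2 ≤ (M * h) ^ 2 := by gcongr
          rw [show M ^ 2 * h * (h * v / y ^ 2) = v * (((M * h) ^ 2) / y ^ 2) by ring]
          refine le_mul_of_one_le_right hv.le ?_
          rwa [one_le_div (by positivity)]
        have e2 : A = (M ^ 2 * h) ^ s := by
          rw [hA, Real.mul_rpow (by positivity) hh.le, ← Real.rpow_natCast,
            ← Real.rpow_mul hM0.le]
          norm_num
        calc v ^ (p - 2 + s) = v ^ (p - 2) * v ^ s := Real.rpow_add hv _ _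
          _ ≤ v ^ (p - 2) * (M ^ 2 * h * (h * v / y ^ 2)) ^ s := by gcongr
          _ = A * (v ^ (p - 2) * (h * v / y ^ 2) ^ s) := by
              rw [e2, Real.mul_rpow (by positivity) (by positivity)]; ring
    _ ≤ ENNReal.ofReal A * (ENNReal.ofReal Real.pi * seminormF p (p - 2) s f ^ p) := by
        rw [lintegral_const_mul' _ _ ENNReal.ofReal_ne_top]
        gcongr
        exact (lintegral_mono_set hS).trans (lintegral_le_seminormF hp _ _ f ha)
    _ = _ := by
        rw [← mul_assoc, ← ENNReal.ofReal_mul hA0, hA]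
        congr 2; ring

theorem rpow_le_four_rpow_abs_mul {δ v : ℝ} (hδ : 0 < δ) (h1 : δ / 4 ≤ v) (h2 : v ≤ 4 * δ)
    (e : ℝ) : δ ^ e ≤ 4 ^ |e| * v ^ e := by
  have hv : 0 < v := by linarith
  rcases le_total 0 e with he | he
  · rw [abs_of_nonneg he, ← Real.mul_rpow (by norm_num) hv.le]
    gcongr
    linarith
  · rw [abs_of_nonpos he]
    have h4 : (4 : ℝ) ^ (-e) = (1 / 4) ^ e := by
      rw [one_div, Real.inv_rpow (by norm_num), Real.rpow_neg (by norm_num)]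
    rw [h4, ← Real.mul_rpow (by norm_num) hv.le]
    exact Real.rpow_le_rpow_of_nonpos (by positivity) (by linarith) he

/-! ### Oscillation and growth of `f` along a radius -/

/-- The point of the radius through `ω` at distance `δ` from the unit circle. -/
noncomputable def radialPoint (δ : ℝ) (ω : ℂ) : ℂ := ((1 - δ : ℝ) : ℂ) * ω

theorem norm_radialPoint {δ : ℝ} (hδ : δ ≤ 1) {ω : ℂ} (hω : ‖ω‖ = 1) :
    ‖radialPoint δ ω‖ = 1 - δ := by
  rw [radialPoint, norm_mul, hω, mul_one, Complex.norm_real, Real.norm_of_nonneg (by linarith)]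

theorem norm_mem_of_mem_ball_radialPoint {δ : ℝ} (hδ1 : δ ≤ 1) {ω u : ℂ}
    (hω : ‖ω‖ = 1) (hu : u ∈ Metric.ball (radialPoint δ ω) (3 / 4 * δ)) :
    δ / 4 < 1 - ‖u‖ ∧ 1 - ‖u‖ < 7 / 4 * δ := by
  rw [mem_ball_iff_norm] at hu
  have h1 := norm_sub_norm_le u (radialPoint δ ω)
  have h2 := norm_sub_norm_le (radialPoint δ ω) u
  rw [norm_sub_rev] at h2
  rw [norm_radialPoint hδ1 hω] at h1 h2
  constructor <;> linarith

theorem ball_radialPoint_subset {δ : ℝ} (hδ : 0 < δ) (hδ1 : δ ≤ 1) {ω : ℂ}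
    (hω : ‖ω‖ = 1) : Metric.ball (radialPoint δ ω) (3 / 4 * δ) ⊆ unitDisk := by
  intro u hu
  have := (norm_mem_of_mem_ball_radialPoint hδ1 hω hu).1
  rw [mem_ball_zero_iff]
  linarith

theorem setLIntegral_energyDensity_radial_le {p s : ℝ} (hp : 0 < p) (hs : 0 < s) (f : ℂ → ℂ)
    {δ : ℝ} (hδ : 0 < δ) (hδ1 : δ ≤ 1) {ω : ℂ} (hω : ‖ω‖ = 1) :
    ∫⁻ u in Metric.ball (radialPoint δ ω) (3 / 4 * δ), energyDensity p s f u ≤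
      ENNReal.ofReal (Real.pi * 2 ^ (2 * s) * 2 ^ s) * ENNReal.ofReal (δ ^ s) *
        seminormF p (p - 2) s f ^ p := by
  have hn := norm_radialPoint hδ1 hω
  have ha : radialPoint δ ω ∈ unitDisk := by rw [mem_ball_zero_iff, hn]; linarith
  have h := setLIntegral_energyDensity_le hp hs f ha (M := 2) measurableSet_ball
    (ball_radialPoint_subset hδ hδ1 hω) (fun u hu => by
      refine (norm_one_sub_conj_mul_le _ u (mem_ball_zero_iff.1 ha).le).trans ?_
      rw [mem_ball_iff_norm, norm_sub_rev] at hu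
      rw [hn]
      nlinarith)
  refine h.trans ?_
  rw [hn, ← ENNReal.ofReal_mul (by positivity)]
  gcongr ENNReal.ofReal ?_ * _
  rw [mul_assoc (Real.pi * 2 ^ (2 * s)), ← Real.mul_rpow (by norm_num) hδ.le]
  have : 0 ≤ 1 - (1 - δ) ^ 2 := by nlinarith
  gcongr
  nlinarith

/-- Each point of the radial segment is the center of a disk of radius `δ/4` inside the given one,
where `1 - |u|^2` is comparable to `δ`. The sub-mean value property bounds `|f'|^p` by
`δ^(-(p-2+s)-2)` times the energy; the mean value inequality over length at most `δ` contributes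
`δ^p`, leaving `δ^(-s)`. -/
theorem exists_enorm_sub_rpow_le_lintegral {p : ℝ} (hp : 0 < p) (s : ℝ) :
    ∃ C : ℝ≥0, ∀ f : ℂ → ℂ, DifferentiableOn ℂ f unitDisk → ∀ δ : ℝ, 0 < δ → δ ≤ 1 →
      ∀ ω : ℂ, ‖ω‖ = 1 → ∀ t t' : ℝ, t ∈ Icc (1 - δ) (1 - δ / 2) → t' ∈ Icc (1 - δ) (1 - δ / 2) →
      ∫⁻ u in Metric.ball (radialPoint δ ω) (3 / 4 * δ), energyDensity p s f u ≠ ∞ →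
      ‖f (t' * ω) - f (t * ω)‖ₑ ^ p ≤ C * ENNReal.ofReal (δ ^ (-s)) *
        ∫⁻ u in Metric.ball (radialPoint δ ω) (3 / 4 * δ), energyDensity p s f u := by
  obtain ⟨C, hC⟩ := sq_mul_rpow_enorm_le_lintegral hp
  set e := p - 2 + s with he
  refine ⟨C * (16 * 4 ^ |e|), fun f hf δ hδ hδ1 ω hω t t' ht ht' hX => ?_⟩
  set B := Metric.ball (radialPoint δ ω) (3 / 4 * δ) with hB
  set X := ∫⁻ u in B, energyDensity p s f u with hXdef
  have hderiv : DifferentiableOn ℂ (deriv f) unitDisk := hf.deriv Metric.isOpen_ball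
  have hB1 : ∫⁻ u in B, ‖deriv f u‖ₑ ^ p ≤ ENNReal.ofReal (4 ^ |e| * δ ^ (-e)) * X := by
    rw [hXdef, ← lintegral_const_mul' _ _ ENNReal.ofReal_ne_top]
    refine setLIntegral_mono' measurableSet_ball fun u hu => ?_
    obtain ⟨h1, h2⟩ := norm_mem_of_mem_ball_radialPoint hδ1 hω hu
    have hv1 : δ / 4 ≤ 1 - ‖u‖ ^ 2 := by nlinarith [norm_nonneg u]
    have hv2 : 1 - ‖u‖ ^ 2 ≤ 4 * δ := by nlinarith [norm_nonneg u]
    have h3 := rpow_le_four_rpow_abs_mul hδ hv1 hv2 e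
    rw [energyDensity, mul_left_comm, ← ENNReal.ofReal_mul (by positivity)]
    refine le_mul_of_one_le_right zero_le ?_
    rw [ENNReal.one_le_ofReal]
    calc (1 : ℝ) = δ ^ (-e) * δ ^ e := by rw [← Real.rpow_add hδ]; simp
      _ ≤ δ ^ (-e) * (4 ^ |e| * (1 - ‖u‖ ^ 2) ^ e) := by gcongr
      _ = _ := by ring
  have hpt : ∀ τ ∈ Icc (1 - δ) (1 - δ / 2), ENNReal.ofReal ((δ / 4) ^ 2) *
      ‖deriv f (τ * ω)‖ₑ ^ p ≤ C * (ENNReal.ofReal (4 ^ |e| * δ ^ (-e)) * X) := by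
    intro τ hτ
    have hτn : ‖(τ : ℂ) * ω‖ = τ := by
      rw [norm_mul, hω, mul_one, Complex.norm_real, Real.norm_of_nonneg (by linarith [hτ.1])]
    have hsub : Metric.closedBall ((τ : ℂ) * ω) (δ / 4) ⊆ unitDisk := by
      intro w hw
      rw [mem_closedBall_iff_norm] at hw
      rw [mem_ball_zero_iff]
      have := norm_sub_norm_le w ((τ : ℂ) * ω)
      rw [hτn] at this
      linarith [hτ.2]
    refine (hC (deriv f) _ (δ / 4) (by positivity) (hderiv.mono hsub)).trans ?_
    gcongr
    refine (lintegral_mono_set ?_).trans hB1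
    refine Metric.ball_subset_ball' ?_
    have : dist ((τ : ℂ) * ω) (radialPoint δ ω) = τ - (1 - δ) := by
      rw [radialPoint, dist_eq_norm, ← sub_mul, norm_mul, hω, mul_one, ← Complex.ofReal_sub,
        Complex.norm_real, Real.norm_of_nonneg (by linarith [hτ.1])]
    rw [this]
    linarith [hτ.2]
  set K : ℝ := (C * 16 * 4 ^ |e| * δ ^ (-e - 2) * X.toReal) ^ (1 / p) with hK
  have hK0 : 0 ≤ K := by positivity
  have hKp : K ^ p = C * 16 * 4 ^ |e| * δ ^ (-e - 2) * X.toReal := by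
    rw [hK, ← Real.rpow_mul (by positivity), one_div_mul_cancel hp.ne', Real.rpow_one]
  have hbd : ∀ τ ∈ Icc (1 - δ) (1 - δ / 2), ‖deriv f (τ * ω)‖ ≤ K := by
    intro τ hτ
    rw [← Real.rpow_le_rpow_iff (norm_nonneg _) hK0 hp, hKp]
    have h := hpt τ hτ
    rw [← ENNReal.ofReal_toReal hX, ← ENNReal.ofReal_coe_nnreal, ← ofReal_norm,
      ENNReal.ofReal_rpow_of_nonneg (norm_nonneg _) hp.le, ← ENNReal.ofReal_mul (by positivity),
      ← ENNReal.ofReal_mul (by positivity), ← ENNReal.ofReal_mul (by positivity),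
      ENNReal.ofReal_le_ofReal_iff (by positivity)] at h
    rw [Real.rpow_sub hδ, Real.rpow_two]
    have h2 : ‖deriv f (τ * ω)‖ ^ p = (16 / δ ^ 2) * ((δ / 4) ^ 2 * ‖deriv f (τ * ω)‖ ^ p) := by
      field_simp; ring
    rw [h2]
    calc _ ≤ (16 / δ ^ 2) * (C * (4 ^ |e| * δ ^ (-e) * X.toReal)) := by gcongr
      _ = _ := by ring
  have hseg : ∀ w ∈ segment ℝ ((t : ℂ) * ω) ((t' : ℂ) * ω), ∃ τ ∈ Icc (1 - δ) (1 - δ / 2),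
      w = τ * ω := by
    rintro w ⟨α, β, hα, hβ, hαβ, rfl⟩
    refine ⟨α * t + β * t', (convex_Icc _ _) ht ht' hα hβ hαβ, ?_⟩
    simp only [Complex.real_smul]
    push_cast
    ring
  have hmv : ‖f (t' * ω) - f (t * ω)‖ ≤ K * ‖(t' : ℂ) * ω - t * ω‖ := by
    refine Convex.norm_image_sub_le_of_norm_deriv_le (s := segment ℝ ((t : ℂ) * ω) ((t' : ℂ) * ω))
      ?_ ?_ (convex_segment _ _) (left_mem_segment _ _ _) (right_mem_segment _ _ _)
    · intro w hw
      obtain ⟨τ, hτ, rfl⟩ := hseg w hw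
      refine hf.differentiableAt (Metric.isOpen_ball.mem_nhds ?_)
      rw [mem_ball_zero_iff, norm_mul, hω, mul_one, Complex.norm_real,
        Real.norm_of_nonneg (by linarith [hτ.1])]
      linarith [hτ.2]
    · intro w hw
      obtain ⟨τ, hτ, rfl⟩ := hseg w hw
      exact hbd τ hτ
  have hdist : ‖(t' : ℂ) * ω - t * ω‖ ≤ δ := by
    rw [← sub_mul, norm_mul, hω, mul_one, ← Complex.ofReal_sub, Complex.norm_real,
      Real.norm_eq_abs, abs_le]
    constructor <;> linarith [ht.1, ht.2, ht'.1, ht'.2]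
  have hfin : ‖f (t' * ω) - f (t * ω)‖ ^ p ≤
      (C * (16 * 4 ^ |e|)) * δ ^ (-s) * X.toReal := by
    calc ‖f (t' * ω) - f (t * ω)‖ ^ p ≤ (K * δ) ^ p := by gcongr; exact hmv.trans (by gcongr)
      _ = C * 16 * 4 ^ |e| * (δ ^ (-e - 2) * δ ^ p) * X.toReal := by
          rw [Real.mul_rpow hK0 hδ.le, hKp]; ring
      _ = C * 16 * 4 ^ |e| * δ ^ (-s) * X.toReal := by
          rw [← Real.rpow_add hδ]
          congr 3
          rw [he]; ring
      _ = _ := by ring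
  rw [← ENNReal.ofReal_toReal hX, ← ofReal_norm,
    ENNReal.ofReal_rpow_of_nonneg (norm_nonneg _) hp.le, ← ENNReal.ofReal_coe_nnreal,
    ← ENNReal.ofReal_mul (by positivity), ← ENNReal.ofReal_mul (by positivity)]
  exact ENNReal.ofReal_le_ofReal (by push_cast; exact hfin)

theorem exists_enorm_sub_le_seminormF {p s : ℝ} (hp : 0 < p) (hs : 0 < s) :
    ∃ C : ℝ≥0, ∀ f ∈ spaceF p (p - 2) s, ∀ δ : ℝ, 0 < δ → δ ≤ 1 →
      ∀ ω : ℂ, ‖ω‖ = 1 → ∀ t t' : ℝ, t ∈ Icc (1 - δ) (1 - δ / 2) → t' ∈ Icc (1 - δ) (1 - δ / 2) →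
      ‖f (t' * ω) - f (t * ω)‖ₑ ≤ C * seminormF p (p - 2) s f := by
  obtain ⟨C, hC⟩ := exists_enorm_sub_rpow_le_lintegral hp s
  set A : ℝ := Real.pi * 2 ^ (2 * s) * 2 ^ s with hA
  have hA0 : 0 ≤ A := by positivity
  refine ⟨(C * A.toNNReal) ^ (1 / p), fun f hf δ hδ hδ1 ω hω t t' ht ht' => ?_⟩
  have hE := setLIntegral_energyDensity_radial_le hp hs f hδ hδ1 hω
  have hfin : seminormF p (p - 2) s f ^ p ≠ ∞ :=
    ENNReal.rpow_ne_top_of_nonneg hp.le hf.2.ne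
  have hX : ∫⁻ u in Metric.ball (radialPoint δ ω) (3 / 4 * δ), energyDensity p s f u ≠ ∞ :=
    ne_top_of_le_ne_top (by finiteness) hE
  have h := hC f hf.1 δ hδ hδ1 ω hω t t' ht ht' hX
  rw [← ENNReal.rpow_le_rpow_iff hp, ENNReal.mul_rpow_of_nonneg _ _ hp.le,
    ENNReal.coe_rpow_of_nonneg _ (by positivity), ← ENNReal.rpow_mul, one_div_mul_cancel hp.ne',
    ENNReal.rpow_one]
  calc _ ≤ C * ENNReal.ofReal (δ ^ (-s)) * (ENNReal.ofReal A * ENNReal.ofReal (δ ^ s) *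
          seminormF p (p - 2) s f ^ p) := h.trans (by gcongr)
    _ = C * ENNReal.ofReal A * (ENNReal.ofReal (δ ^ (-s)) * ENNReal.ofReal (δ ^ s)) *
          seminormF p (p - 2) s f ^ p := by ring
    _ = _ := by
        rw [← ENNReal.ofReal_mul (by positivity), ← Real.rpow_add hδ]
        simp [ENNReal.ofReal]

/-- Logarithmic growth of functions in `F(p, p - 2, s)`, along dyadic points of a radius. -/
theorem exists_enorm_radialPoint_le {p s : ℝ} (hp : 0 < p) (hs : 0 < s) :
    ∃ C : ℝ≥0, ∀ f ∈ spaceF p (p - 2) s, ∀ ω : ℂ, ‖ω‖ = 1 → ∀ J : ℕ,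
      ‖f (radialPoint ((1 / 2) ^ J) ω)‖ₑ ≤ C * (J + 1) * normF p (p - 2) s f := by
  obtain ⟨C, hC⟩ := exists_enorm_sub_le_seminormF hp hs
  refine ⟨C + 1, fun f hf ω hω J => ?_⟩
  have h : ‖f (radialPoint ((1 / 2) ^ J) ω)‖ₑ ≤ ‖f 0‖ₑ + J * (C * seminormF p (p - 2) s f) := by
    induction J with
    -- Generation `0` is the origin, where the norm contributes `|f(0)|`.
    | zero => simp [radialPoint]
    | succ J ih =>
      have hδ : (0 : ℝ) < (1 / 2) ^ J := by positivity
      have h1 := hC f hf ((1 / 2) ^ J) hδ (pow_le_one₀ (by norm_num) (by norm_num)) ω hω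
        (1 - (1 / 2) ^ J) (1 - (1 / 2) ^ (J + 1)) ⟨le_rfl, by linarith⟩
        ⟨by rw [pow_succ]; linarith, by rw [pow_succ]; linarith⟩
      have e : f (radialPoint ((1 / 2) ^ (J + 1)) ω) = f (radialPoint ((1 / 2) ^ J) ω) +
          (f (radialPoint ((1 / 2) ^ (J + 1)) ω) - f (radialPoint ((1 / 2) ^ J) ω)) := by ring
      rw [e]
      refine (enorm_add_le _ _).trans ?_
      calc _ ≤ (‖f 0‖ₑ + J * (C * seminormF p (p - 2) s f)) + C * seminormF p (p - 2) s f :=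
            add_le_add ih h1
        _ = _ := by push_cast; ring
  refine h.trans ?_
  rw [normF]
  push_cast
  have h1 : (1 : ℝ≥0∞) ≤ (C + 1) * (J + 1) :=
    one_le_mul (le_add_left le_rfl) (le_add_left le_rfl)
  have h2 : (J : ℝ≥0∞) * C ≤ (C + 1) * (J + 1) := by
    rw [mul_comm]
    gcongr <;> exact le_self_add
  rw [mul_add, ← mul_assoc]
  gcongr
  exact le_mul_of_one_le_left zero_le h1

/-- Pairs `(z, u)` with `u` close to the dyadic point of generation `j` on the radius of `z`, where
this point precedes `z`. -/
def radialRegion (j : ℕ) : Set (ℂ × ℂ) :=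
  {q | 1 - (1 / 2 : ℝ) ^ j < ‖q.1‖ ∧
    dist q.2 (radialPoint ((1 / 2) ^ j) (q.1 / ‖q.1‖)) < 3 / 4 * (1 / 2) ^ j}

theorem measurableSet_radialRegion (j : ℕ) : MeasurableSet (radialRegion j) := by
  unfold radialRegion radialPoint
  have h1 : Measurable fun q : ℂ × ℂ => q.1 / (‖q.1‖ : ℂ) :=
    measurable_fst.div (Complex.measurable_ofReal.comp measurable_fst.norm)
  exact MeasurableSet.inter (measurableSet_lt measurable_const measurable_fst.norm)
    (measurableSet_lt (measurable_snd.dist (h1.const_mul _)) measurable_const)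

theorem exists_enorm_sub_radialPoint_rpow_le {p s : ℝ} (hp : 0 < p) (hs : 0 < s) :
    ∃ C : ℝ≥0, ∀ f ∈ spaceF p (p - 2) s, ∀ z ∈ unitDisk, ∀ J : ℕ, 1 - (1 / 2 : ℝ) ^ J < ‖z‖ →
      ‖f z - f (radialPoint ((1 / 2) ^ J) (z / ‖z‖))‖ₑ ^ p ≤
        C * ∑' j : ℕ, if J ≤ j then ((j : ℝ≥0∞) + 1) ^ p * ENNReal.ofReal (((1 / 2) ^ j) ^ (-s)) *
          ∫⁻ u, (radialRegion j).indicator (fun q => energyDensity p s f q.2) (z, u) else 0 := by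
  obtain ⟨C₁, hC₁⟩ := rpow_sum_le_mul_sum_rpow hp
  obtain ⟨C₂, hC₂⟩ := exists_enorm_sub_rpow_le_lintegral hp s
  refine ⟨C₁ * C₂, fun f hf z hz J hJ => ?_⟩
  rw [mem_ball_zero_iff] at hz
  have hJ1 : ∀ j : ℕ, (1 / 2 : ℝ) ^ j ≤ 1 := fun j => pow_le_one₀ (by norm_num) (by norm_num)
  have hz0 : 0 < ‖z‖ := by linarith [hJ1 J]
  set ω : ℂ := z / ‖z‖ with hω
  have hωn : ‖ω‖ = 1 := by
    rw [hω, norm_div, Complex.norm_real, norm_norm, div_self hz0.ne']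
  have hzω : z = (‖z‖ : ℂ) * ω := by
    rw [hω, mul_div_cancel₀]
    exact_mod_cast hz0.ne'
  obtain ⟨N₀, hN₀⟩ := exists_pow_lt_of_lt_one (sub_pos.2 hz) (by norm_num : (1 / 2 : ℝ) < 1)
  set N := max J N₀ with hN
  have hN1 : (1 / 2 : ℝ) ^ N ≤ 1 - ‖z‖ :=
    (pow_le_pow_of_le_one (by norm_num) (by norm_num) (le_max_right _ _)).trans hN₀.le
  -- Dyadic radii stopped at `|z|`: the telescoping sum ends exactly at `z`, and increments of
  -- generations beyond `z` vanish.
  set ρ : ℕ → ℝ := fun j => min (1 - (1 / 2) ^ j) ‖z‖ with hρ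
  have hρJ : (ρ J : ℂ) * ω = radialPoint ((1 / 2) ^ J) ω := by
    rw [hρ, radialPoint]; dsimp only; rw [min_eq_left hJ.le]
  have hρN : (ρ N : ℂ) * ω = z := by
    rw [hρ]; dsimp only; rw [min_eq_right (by linarith), ← hzω]
  set x : ℕ → ℝ≥0∞ := fun j => ‖f (ρ (j + 1) * ω) - f (ρ j * ω)‖ₑ with hx
  have htel : ‖f z - f (radialPoint ((1 / 2) ^ J) ω)‖ₑ ≤ ∑ j ∈ Finset.Ico J N, x j := by
    rw [← hρJ]
    conv_lhs => rw [← hρN]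
    rw [← Finset.sum_Ico_sub (fun j => f (ρ j * ω)) (le_max_left J N₀)]
    exact enorm_sum_le _ _
  have hterm : ∀ j, x j ^ p ≤ C₂ * (ENNReal.ofReal (((1 / 2) ^ j) ^ (-s)) *
      ∫⁻ u, (radialRegion j).indicator (fun q => energyDensity p s f q.2) (z, u)) := by
    intro j
    have hδ : (0 : ℝ) < (1 / 2) ^ j := by positivity
    rcases lt_or_ge (1 - (1 / 2 : ℝ) ^ j) ‖z‖ with hlt | hge
    · have hE := setLIntegral_energyDensity_radial_le hp hs f hδ (hJ1 j) hωn
      have hfin : seminormF p (p - 2) s f ^ p ≠ ∞ :=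
        ENNReal.rpow_ne_top_of_nonneg hp.le hf.2.ne
      have hX := ne_top_of_le_ne_top (by finiteness) hE
      have h := hC₂ f hf.1 _ hδ (hJ1 j) ω hωn (ρ j) (ρ (j + 1))
        (by
          rw [hρ]; dsimp only; rw [min_eq_left hlt.le]
          exact ⟨le_rfl, by linarith⟩)
        (by
          rw [hρ]; dsimp only
          rw [pow_succ]
          exact ⟨le_min (by linarith) hlt.le, (min_le_left _ _).trans (by linarith)⟩) hX
      rw [mul_assoc] at h
      refine h.trans (le_of_eq ?_)
      congr 2
      rw [← lintegral_indicator measurableSet_ball]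
      refine lintegral_congr fun u => ?_
      by_cases hu : u ∈ Metric.ball (radialPoint ((1 / 2) ^ j) ω) (3 / 4 * (1 / 2) ^ j)
      · have hmem : (z, u) ∈ radialRegion j := ⟨hlt, hu⟩
        rw [indicator_of_mem hu, indicator_of_mem hmem]
      · have hmem : (z, u) ∉ radialRegion j := fun h => hu h.2
        rw [indicator_of_notMem hu, indicator_of_notMem hmem]
    · have : x j = 0 := by
        have h2 : ρ (j + 1) = ρ j := by
          rw [hρ]; dsimp only
          rw [min_eq_right hge, min_eq_right]
          rw [pow_succ]; linarith
        rw [hx]; dsimp only; rw [h2, sub_self, enorm_zero]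
      rw [this, ENNReal.zero_rpow_of_pos hp]
      exact zero_le
  calc _ ≤ (∑ j ∈ Finset.Ico J N, x j) ^ p := by gcongr
    _ ≤ C₁ * ∑ j ∈ Finset.Ico J N, ((j : ℝ≥0∞) + 1) ^ p * x j ^ p := hC₁ _ _
    _ ≤ C₁ * ∑ j ∈ Finset.Ico J N, C₂ * (if J ≤ j then ((j : ℝ≥0∞) + 1) ^ p *
          ENNReal.ofReal (((1 / 2) ^ j) ^ (-s)) *
          ∫⁻ u, (radialRegion j).indicator (fun q => energyDensity p s f q.2) (z, u) else 0) := by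
        refine mul_le_mul_right (Finset.sum_le_sum fun j hj => ?_) _
        rw [if_pos (Finset.mem_Ico.1 hj).1]
        calc _ ≤ ((j : ℝ≥0∞) + 1) ^ p * _ := mul_le_mul_right (hterm j) _
          _ = _ := by ring
    _ ≤ _ := by
        rw [← Finset.mul_sum, ← mul_assoc]
        push_cast
        gcongr
        exact ENNReal.sum_le_tsum _

/-! ### Geometry and measure of Carleson boxes -/

theorem measurableSet_carlesonBox (θ ℓ : ℝ) : MeasurableSet (carlesonBox θ ℓ) := by
  have harc : MeasurableSet (circleArc θ ℓ) := by
    have : circleArc θ ℓ = (fun φ : ℝ => Complex.exp (φ * Complex.I)) ''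
        Metric.closedBall θ (Real.pi * ℓ) := by
      ext ζ
      simp only [circleArc, mem_ofPred_eq, mem_image, Metric.mem_closedBall, Real.dist_eq]
      constructor
      · rintro ⟨φ, h, rfl⟩; exact ⟨φ, h, rfl⟩
      · rintro ⟨φ, h, rfl⟩; exact ⟨φ, h, rfl⟩
    rw [this]
    exact ((isCompact_closedBall _ _).image (by fun_prop)).measurableSet
  have hcoe : Measurable fun z : unitDisk => (z : ℂ) := measurable_subtype_coe
  refine MeasurableSet.inter ?_ (MeasurableSet.inter ?_ ?_)
  · exact measurableSet_lt measurable_const hcoe.norm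
  · exact measurableSet_lt hcoe.norm measurable_const
  · exact (hcoe.div (Complex.measurable_ofReal.comp hcoe.norm)) harc

theorem norm_exp_sub_exp_le (x y : ℝ) :
    ‖Complex.exp (x * Complex.I) - Complex.exp (y * Complex.I)‖ ≤ |x - y| := by
  have e : Complex.exp (x * Complex.I) - Complex.exp (y * Complex.I) =
      Complex.exp (y * Complex.I) * (Complex.exp (Complex.I * (x - y : ℝ)) - 1) := by
    rw [mul_sub, ← Complex.exp_add, mul_one]
    congr 2
    push_cast; ring
  rw [e, norm_mul, Complex.norm_exp_ofReal_mul_I, one_mul]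
  exact Real.norm_exp_I_mul_ofReal_sub_one_le

theorem norm_pos_of_mem_carlesonBox {θ ℓ : ℝ} {z : unitDisk} (hz : z ∈ carlesonBox θ ℓ) :
    0 < ‖(z : ℂ)‖ := by
  rw [norm_pos_iff]
  intro h
  obtain ⟨φ, -, h2⟩ := hz.2.2
  rw [h] at h2
  exact Complex.exp_ne_zero (φ * Complex.I) (by rw [← h2, zero_div])

theorem norm_div_norm_sub_le_of_mem_carlesonBox {θ ℓ : ℝ} {z : unitDisk}
    (hz : z ∈ carlesonBox θ ℓ) :
    ‖(z : ℂ) / (‖(z : ℂ)‖ : ℂ) - Complex.exp (θ * Complex.I)‖ ≤ Real.pi * ℓ := by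
  obtain ⟨φ, h1, h2⟩ := hz.2.2
  rw [h2]
  exact (norm_exp_sub_exp_le _ _).trans h1

/-- Converts chords into angles: the principal argument of `z / z₁` is at most four times the chord
between the directions. -/
theorem mem_carlesonBox_of_norm_sub_le {ℓ : ℝ} {z z₁ : unitDisk} (hz : (z : ℂ) ≠ 0)
    (hz₁ : (z₁ : ℂ) ≠ 0) (hℓ : 1 - ℓ < ‖(z : ℂ)‖)
    (h : ℓ = 1 ∨ 4 * ‖(z : ℂ) / (‖(z : ℂ)‖ : ℂ) - (z₁ : ℂ) / (‖(z₁ : ℂ)‖ : ℂ)‖ ≤ Real.pi * ℓ) :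
    z ∈ carlesonBox (Complex.arg z₁) ℓ := by
  refine ⟨hℓ, mem_ball_zero_iff.1 z.2, ?_⟩
  have hdir : ∀ w : ℂ, w ≠ 0 → w / (‖w‖ : ℂ) = Complex.exp (w.arg * Complex.I) := by
    intro w hw
    have hw' : (‖w‖ : ℂ) ≠ 0 := by exact_mod_cast norm_ne_zero_iff.2 hw
    rw [div_eq_iff hw', mul_comm]
    exact (Complex.norm_mul_exp_arg_mul_I w).symm
  set ψ := Complex.arg ((z : ℂ) / z₁) with hψ
  have hψ' : Complex.exp (ψ * Complex.I) =
      Complex.exp (Complex.arg z * Complex.I) / Complex.exp (Complex.arg z₁ * Complex.I) := by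
    rw [← hdir _ hz, ← hdir _ hz₁, ← hdir _ (div_ne_zero hz hz₁), norm_div]
    push_cast
    field_simp
  have hne := Complex.exp_ne_zero ((Complex.arg z₁ : ℂ) * Complex.I)
  refine ⟨Complex.arg z₁ + ψ, ?_, ?_⟩
  · rw [add_sub_cancel_left]
    rcases h with rfl | h
    · rw [mul_one]; exact Complex.abs_arg_le_pi _
    · have h4 := abs_div_four_le_norm_one_sub (ρ := 1) zero_le_one (Complex.abs_arg_le_pi
        ((z : ℂ) / z₁))
      rw [hdir _ hz, hdir _ hz₁] at h
      have e : (1 : ℂ) - (1 : ℝ) * (Real.cos ψ + Real.sin ψ * Complex.I) =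
          (Complex.exp (Complex.arg z₁ * Complex.I) - Complex.exp (Complex.arg z * Complex.I)) /
            Complex.exp (Complex.arg z₁ * Complex.I) := by
        rw [sub_div, div_self hne, ← hψ', Complex.exp_mul_I]
        push_cast; ring
      rw [e, norm_div, Complex.norm_exp_ofReal_mul_I, div_one, norm_sub_rev] at h4
      linarith
  · rw [hdir _ hz]
    push_cast
    rw [add_mul, Complex.exp_add, hψ', mul_div_cancel₀ _ hne]

theorem log_two_div_pos {ℓ : ℝ} (hℓ : ℓ ∈ Ioc (0 : ℝ) 1) : 0 < Real.log (2 / ℓ) := by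
  refine Real.log_pos ?_
  rw [one_lt_div hℓ.1]
  linarith [hℓ.2]

theorem measure_carlesonBox_le {p s : ℝ} {μ : Measure unitDisk} {c : ℝ≥0} {θ ℓ : ℝ}
    (hℓ : ℓ ∈ Ioc (0 : ℝ) 1) (h : logCarlesonRatio p s μ θ ℓ ≤ c) :
    μ (carlesonBox θ ℓ) ≤ c * ENNReal.ofReal (ℓ ^ s * Real.log (2 / ℓ) ^ (-p)) := by
  have hL := log_two_div_pos hℓ
  have hℓ0 := hℓ.1
  have hpos : 0 < 1 / ℓ ^ s * Real.log (2 / ℓ) ^ p := by positivity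
  rw [logCarlesonRatio, mul_comm, ← ENNReal.le_div_iff_mul_le
    (Or.inl (by simpa using hpos)) (Or.inl ENNReal.ofReal_ne_top)] at h
  refine h.trans (le_of_eq ?_)
  rw [div_eq_mul_inv, ← ENNReal.ofReal_inv_of_pos hpos]
  congr 2
  rw [Real.rpow_neg hL.le]
  field_simp

/-! ### Summation over dyadic generations and the embedding estimate -/

theorem half_pow_le_one (j : ℕ) : (1 / 2 : ℝ) ^ j ≤ 1 := pow_le_one₀ (by norm_num) (by norm_num)

/-- The length of an arc that contains all directions within `O(2^(-j))` of a given one. -/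
noncomputable def dyadicArcLength (j : ℕ) : ℝ := min 1 (4 * (1 / 2) ^ j)

theorem dyadicArcLength_mem (j : ℕ) : dyadicArcLength j ∈ Ioc (0 : ℝ) 1 :=
  ⟨lt_min one_pos (by positivity), min_le_left _ _⟩

/-- The cancellation behind the theorem: the cost `(j + 1)^p 2^(js)` of generation `j` against the
Carleson bound for a box of length `O(2^(-j))`, whose logarithm is comparable to `j + 1`. -/
theorem dyadicArcLength_weight_le {p s : ℝ} (hp : 0 < p) (hs : 0 < s) (j : ℕ) :
    ((j : ℝ) + 1) ^ p * ((1 / 2 : ℝ) ^ j) ^ (-s) *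
      (dyadicArcLength j ^ s * Real.log (2 / dyadicArcLength j) ^ (-p)) ≤ 6 ^ p * 4 ^ s := by
  have hℓ := dyadicArcLength_mem j
  have hL := log_two_div_pos hℓ
  have hδ : (0 : ℝ) < (1 / 2) ^ j := by positivity
  have h1 : dyadicArcLength j ^ s ≤ 4 ^ s * ((1 / 2 : ℝ) ^ j) ^ s := by
    rw [← Real.mul_rpow (by norm_num) hδ.le]
    exact Real.rpow_le_rpow hℓ.1.le (min_le_right _ _) hs.le
  have h2 : ((j : ℝ) + 1) ≤ 6 * Real.log (2 / dyadicArcLength j) := by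
    have hl2 := Real.log_two_gt_d9
    rcases le_or_gt j 2 with hj | hj
    · have : Real.log 2 ≤ Real.log (2 / dyadicArcLength j) := by
        refine Real.log_le_log (by norm_num) ?_
        rw [le_div_iff₀ hℓ.1]
        linarith [hℓ.2]
      have hj' : (j : ℝ) ≤ 2 := by exact_mod_cast hj
      linarith
    · obtain ⟨k, rfl⟩ : ∃ k, j = k + 1 := ⟨j - 1, by omega⟩
      have hk : (2 : ℝ) ≤ k := by exact_mod_cast (by omega : 2 ≤ k)
      have : k * Real.log 2 ≤ Real.log (2 / dyadicArcLength (k + 1)) := by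
        rw [← Real.log_pow]
        refine Real.log_le_log (by positivity) ?_
        rw [le_div_iff₀ hℓ.1]
        calc (2 : ℝ) ^ k * dyadicArcLength (k + 1) ≤ 2 ^ k * (4 * (1 / 2) ^ (k + 1)) := by
              gcongr; exact min_le_right _ _
          _ = 2 := by
              rw [one_div, inv_pow, pow_succ]
              field_simp
              norm_num
      push_cast
      nlinarith
  have h3 : ((j : ℝ) + 1) ^ p ≤ 6 ^ p * Real.log (2 / dyadicArcLength j) ^ p := by
    rw [← Real.mul_rpow (by norm_num) hL.le]
    exact Real.rpow_le_rpow (by positivity) h2 hp.le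
  have hℓs : 0 ≤ dyadicArcLength j ^ s := Real.rpow_nonneg hℓ.1.le _
  calc _ ≤ (6 ^ p * Real.log (2 / dyadicArcLength j) ^ p) * ((1 / 2 : ℝ) ^ j) ^ (-s) *
        ((4 ^ s * ((1 / 2 : ℝ) ^ j) ^ s) * Real.log (2 / dyadicArcLength j) ^ (-p)) := by
        gcongr
    _ = 6 ^ p * 4 ^ s * (Real.log (2 / dyadicArcLength j) ^ p *
          Real.log (2 / dyadicArcLength j) ^ (-p)) *
          (((1 / 2 : ℝ) ^ j) ^ (-s) * ((1 / 2 : ℝ) ^ j) ^ s) := by ring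
    _ = _ := by
        rw [← Real.rpow_add hL, ← Real.rpow_add hδ]
        simp

/-- The dyadic annulus of generation `j`. -/
def dyadicAnnulus (j : ℕ) : Set ℂ :=
  {u | (1 / 2 : ℝ) ^ j / 4 < 1 - ‖u‖ ∧ 1 - ‖u‖ < 7 / 4 * (1 / 2) ^ j}

theorem measurableSet_dyadicAnnulus (j : ℕ) : MeasurableSet (dyadicAnnulus j) := by
  have h : Measurable fun u : ℂ => 1 - ‖u‖ := by fun_prop
  exact MeasurableSet.inter (measurableSet_lt measurable_const h)
    (measurableSet_lt h measurable_const)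

/-- The heights in one annulus vary by a factor `7 < 2^3`, so a point lies in at most three
consecutive annuli. -/
theorem tsum_indicator_dyadicAnnulus_le (g : ℂ → ℝ≥0∞) (u : ℂ) :
    ∑' j, (dyadicAnnulus j).indicator g u ≤ 3 * g u := by
  classical
  by_cases hex : ∃ j, u ∈ dyadicAnnulus j
  · set m := Nat.find hex
    have hm : u ∈ dyadicAnnulus m := Nat.find_spec hex
    have hzero : ∀ j ∉ Finset.Icc m (m + 2), (dyadicAnnulus j).indicator g u = 0 := by
      intro j hj
      refine indicator_of_notMem (fun hu => hj ?_) _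
      rw [Finset.mem_Icc]
      refine ⟨Nat.find_min' hex hu, ?_⟩
      by_contra! hlt
      have h1 : (1 / 2 : ℝ) ^ j ≤ (1 / 2) ^ (m + 3) :=
        pow_le_pow_of_le_one (by norm_num) (by norm_num) (by omega)
      rw [pow_add] at h1
      have h2 := hm.1
      have h3 := hu.2
      have h4 : (0 : ℝ) < (1 / 2) ^ m := by positivity
      norm_num at h1
      linarith
    rw [tsum_eq_sum hzero]
    calc _ ≤ ∑ j ∈ Finset.Icc m (m + 2), g u :=
          Finset.sum_le_sum fun j _ => indicator_le_self _ _ _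
      _ = _ := by
          rw [Finset.sum_const, Nat.card_Icc, nsmul_eq_mul, show m + 2 + 1 - m = 3 by omega]
          norm_num
  · have : ∀ j, (dyadicAnnulus j).indicator g u = 0 := fun j =>
      indicator_of_notMem (fun hu => hex ⟨j, hu⟩) _
    simp [this]

/-- Two points `z`, `z₁` that see the same `u` have dyadic points less than `3/2 * 2^(-j)` apart. If
`4 * 2^(-j) ≤ 1`, their directions differ by at most `2 * 2^(-j)`, so all such `z` lie in one box
centered at the direction of `z₁`; otherwise the box of length `1` is used. -/
theorem measure_radialRegion_le {p s : ℝ} {μ : Measure unitDisk} {c : ℝ≥0}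
    (hμ : ∀ θ : ℝ, ∀ ℓ ∈ Ioc (0 : ℝ) 1, logCarlesonRatio p s μ θ ℓ ≤ c) (j : ℕ) (u : ℂ)
    {S : Set unitDisk} (hS : ∀ z ∈ S, (z : ℂ) ≠ 0) :
    μ (S ∩ {z | ((z : ℂ), u) ∈ radialRegion j}) ≤
      c * ENNReal.ofReal (dyadicArcLength j ^ s * Real.log (2 / dyadicArcLength j) ^ (-p)) := by
  rcases (S ∩ {z | ((z : ℂ), u) ∈ radialRegion j}).eq_empty_or_nonempty with he | ⟨z₁, hz₁S, hz₁⟩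
  · rw [he, measure_empty]; exact zero_le
  refine le_trans (measure_mono ?_) (measure_carlesonBox_le (dyadicArcLength_mem j)
    (hμ (Complex.arg z₁) _ (dyadicArcLength_mem j)))
  rintro z ⟨hzS, hz⟩
  have hδ : (0 : ℝ) < (1 / 2) ^ j := by positivity
  have hz0 := hS z hzS
  have hz10 := hS z₁ hz₁S
  refine mem_carlesonBox_of_norm_sub_le hz0 hz10 ?_ ?_
  · have h1 : 1 - (1 / 2 : ℝ) ^ j < ‖(z : ℂ)‖ := hz.1
    have h2 := norm_pos_iff.2 hz0
    rw [dyadicArcLength]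
    rcases le_total 1 (4 * (1 / 2 : ℝ) ^ j) with h | h
    · rw [min_eq_left h]; linarith
    · rw [min_eq_right h]; linarith
  · rw [dyadicArcLength]
    rcases le_total 1 (4 * (1 / 2 : ℝ) ^ j) with h | h
    · exact Or.inl (min_eq_left h)
    · right
      rw [min_eq_right h]
      have h1 := hz.2
      have h2 := hz₁.2
      have h3 := dist_triangle_left (radialPoint ((1 / 2) ^ j) ((z : ℂ) / (‖(z : ℂ)‖ : ℂ)))
        (radialPoint ((1 / 2) ^ j) ((z₁ : ℂ) / (‖(z₁ : ℂ)‖ : ℂ))) u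
      dsimp only at h1 h2
      rw [dist_eq_norm, radialPoint, radialPoint, ← mul_sub, norm_mul, Complex.norm_real,
        Real.norm_of_nonneg (by linarith)] at h3
      set D := ‖(z : ℂ) / (‖(z : ℂ)‖ : ℂ) - (z₁ : ℂ) / (‖(z₁ : ℂ)‖ : ℂ)‖
      have hD : 0 ≤ D := norm_nonneg _
      have hpi := Real.pi_gt_three
      simp only [radialPoint] at h1 h2
      nlinarith

theorem mem_of_mem_radialRegion {θ ℓ : ℝ} {J j : ℕ} (hJ : (1 / 2 : ℝ) ^ J ≤ 2 * ℓ) (hj : J ≤ j)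
    {z : unitDisk} (hz : z ∈ carlesonBox θ ℓ) {u : ℂ} (hu : ((z : ℂ), u) ∈ radialRegion j) :
    u ∈ dyadicAnnulus j ∩ (unitDisk ∩ Metric.closedBall (Complex.exp (θ * Complex.I)) (8 * ℓ)) := by
  have hz0 := norm_pos_of_mem_carlesonBox hz
  have hδ : (0 : ℝ) < (1 / 2) ^ j := by positivity
  have hω : ‖(z : ℂ) / (‖(z : ℂ)‖ : ℂ)‖ = 1 := by
    rw [norm_div, Complex.norm_real, norm_norm, div_self hz0.ne']
  have hball : u ∈ Metric.ball (radialPoint ((1 / 2) ^ j) ((z : ℂ) / (‖(z : ℂ)‖ : ℂ)))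
    (3 / 4 * (1 / 2) ^ j) := hu.2
  refine ⟨norm_mem_of_mem_ball_radialPoint (half_pow_le_one j) hω hball,
    ball_radialPoint_subset hδ (half_pow_le_one j) hω hball, ?_⟩
  have h1 := norm_div_norm_sub_le_of_mem_carlesonBox hz
  set ω := (z : ℂ) / (‖(z : ℂ)‖ : ℂ)
  have h2 : dist (radialPoint ((1 / 2) ^ j) ω) ω = (1 / 2) ^ j := by
    have : radialPoint ((1 / 2) ^ j) ω - ω = ((-(1 / 2) ^ j : ℝ) : ℂ) * ω := by
      rw [radialPoint]; push_cast; ring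
    rw [dist_eq_norm, this, norm_mul, hω, mul_one, Complex.norm_real, norm_neg,
      Real.norm_of_nonneg hδ.le]
  have h3 : (1 / 2 : ℝ) ^ j ≤ (1 / 2) ^ J := pow_le_pow_of_le_one (by norm_num) (by norm_num) hj
  have h4 := dist_triangle4 u (radialPoint ((1 / 2) ^ j) ω) ω (Complex.exp (θ * Complex.I))
  rw [Metric.mem_ball] at hball
  rw [← dist_eq_norm] at h1
  rw [Metric.mem_closedBall]
  have hJ0 : (0 : ℝ) < (1 / 2) ^ J := by positivity
  have hpi := Real.pi_le_four
  -- The distances add up to at most `7/4 * 2^(-j) + πℓ ≤ (7/2 + 4) ℓ`.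
  nlinarith

/-- Tonelli: for fixed `u` the integral over `z` is the energy density at `u` times the measure of
the `z` that see `u`, and that measure absorbs the weight of generation `j`. -/
theorem lintegral_radialRegion_le {p s : ℝ} (hp : 0 < p) (hs : 0 < s) {μ : Measure unitDisk}
    {c : ℝ≥0} (hμ : ∀ θ : ℝ, ∀ ℓ ∈ Ioc (0 : ℝ) 1, logCarlesonRatio p s μ θ ℓ ≤ c) {θ ℓ : ℝ}
    (hℓ : ℓ ∈ Ioc (0 : ℝ) 1) {J j : ℕ} (hJ : (1 / 2 : ℝ) ^ J ≤ 2 * ℓ) (hj : J ≤ j) (f : ℂ → ℂ) :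
    ((j : ℝ≥0∞) + 1) ^ p * ENNReal.ofReal (((1 / 2) ^ j) ^ (-s)) *
      ∫⁻ z in carlesonBox θ ℓ, (∫⁻ u, (radialRegion j).indicator
        (fun q => energyDensity p s f q.2) ((z : ℂ), u)) ∂μ ≤
    ENNReal.ofReal (6 ^ p * 4 ^ s) * c * ∫⁻ u in unitDisk ∩
      Metric.closedBall (Complex.exp (θ * Complex.I)) (8 * ℓ),
      (dyadicAnnulus j).indicator (energyDensity p s f) u := by
  have hbox := (measurableSet_carlesonBox θ ℓ)
  -- The exchange of integrals needs a σ-finite measure; `μ` itself is arbitrary, but the Carleson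
  -- bound makes it finite on boxes.
  have : IsFiniteMeasure (μ.restrict (carlesonBox θ ℓ)) := by
    refine ⟨?_⟩
    rw [Measure.restrict_apply_univ]
    exact (measure_carlesonBox_le hℓ (hμ θ ℓ hℓ)).trans_lt
      (ENNReal.mul_lt_top ENNReal.coe_lt_top ENNReal.ofReal_lt_top)
  have hmeas : Measurable fun q : unitDisk × ℂ => (radialRegion j).indicator
      (fun q => energyDensity p s f q.2) ((q.1 : ℂ), q.2) := by
    have h1 : Measurable ((radialRegion j).indicator (fun q => energyDensity p s f q.2)) :=
      ((measurable_energyDensity p s f).comp measurable_snd).indicator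
        (measurableSet_radialRegion j)
    exact h1.comp ((measurable_subtype_coe.comp measurable_fst).prodMk measurable_snd)
  rw [lintegral_lintegral_swap hmeas.aemeasurable]
  have hS : MeasurableSet (unitDisk ∩ Metric.closedBall (Complex.exp (θ * Complex.I)) (8 * ℓ)) :=
    measurableSet_ball.inter measurableSet_closedBall
  have hc : ((j : ℝ≥0∞) + 1) ^ p * ENNReal.ofReal (((1 / 2) ^ j) ^ (-s)) ≠ ∞ := by finiteness
  have hc' : ENNReal.ofReal (6 ^ p * 4 ^ s) * c ≠ ∞ := by finiteness
  rw [← lintegral_const_mul' _ _ hc, ← lintegral_const_mul' _ _ hc', ← lintegral_indicator hS]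
  refine lintegral_mono fun u => ?_
  have hWm : MeasurableSet {z : unitDisk | ((z : ℂ), u) ∈ radialRegion j} := by
    have h1 : Measurable fun z : unitDisk => ((z : ℂ), u) :=
      measurable_subtype_coe.prodMk measurable_const
    exact h1 (measurableSet_radialRegion j)
  have hin : ∫⁻ z in carlesonBox θ ℓ, (radialRegion j).indicator
        (fun q => energyDensity p s f q.2) ((z : ℂ), u) ∂μ =
      energyDensity p s f u * μ (carlesonBox θ ℓ ∩ {z | ((z : ℂ), u) ∈ radialRegion j}) := by
    rw [inter_comm, ← Measure.restrict_apply hWm, ← lintegral_indicator_const hWm]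
    refine lintegral_congr fun z => ?_
    by_cases hz : ((z : ℂ), u) ∈ radialRegion j
    · rw [indicator_of_mem hz, indicator_of_mem (by exact hz)]
    · rw [indicator_of_notMem hz, indicator_of_notMem (by exact hz)]
  rw [hin]
  rcases (carlesonBox θ ℓ ∩ {z | ((z : ℂ), u) ∈ radialRegion j}).eq_empty_or_nonempty with
    he | ⟨z, hzb, hz⟩
  · rw [he, measure_empty, mul_zero, mul_zero]; exact zero_le
  obtain ⟨hu1, hu2⟩ := mem_of_mem_radialRegion hJ hj hzb hz
  rw [indicator_of_mem hu2, indicator_of_mem hu1]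
  have hm := measure_radialRegion_le hμ j u (S := carlesonBox θ ℓ)
    (fun z hz => norm_pos_iff.1 (norm_pos_of_mem_carlesonBox hz))
  have hj1 : ((j : ℝ≥0∞) + 1) ^ p = ENNReal.ofReal (((j : ℝ) + 1) ^ p) := by
    rw [← ENNReal.ofReal_rpow_of_nonneg (by positivity) hp.le,
      ENNReal.ofReal_add (by positivity) (by positivity)]
    simp
  calc _ ≤ ((j : ℝ≥0∞) + 1) ^ p * ENNReal.ofReal (((1 / 2) ^ j) ^ (-s)) *
        (energyDensity p s f u * (c * ENNReal.ofReal
          (dyadicArcLength j ^ s * Real.log (2 / dyadicArcLength j) ^ (-p)))) := by gcongr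
    _ = ENNReal.ofReal (((j : ℝ) + 1) ^ p * ((1 / 2 : ℝ) ^ j) ^ (-s) *
      (dyadicArcLength j ^ s * Real.log (2 / dyadicArcLength j) ^ (-p))) * c *
        energyDensity p s f u := by
        rw [ENNReal.ofReal_mul (p := ((j : ℝ) + 1) ^ p * ((1 / 2 : ℝ) ^ j) ^ (-s)) (by positivity),
          ENNReal.ofReal_mul (p := ((j : ℝ) + 1) ^ p) (by positivity), hj1]
        ring
    _ ≤ _ := by
        gcongr ENNReal.ofReal ?_ * _ * _
        exact dyadicArcLength_weight_le hp hs j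

/-- Test the seminorm at `a = (1 - ℓ) ζ`: on this set `|1 - conj a u| ≤ 8ℓ + ℓ`, and `1 - |a|^2 ≥
ℓ`. -/
theorem setLIntegral_energyDensity_arc_le {p s : ℝ} (hp : 0 < p) (hs : 0 < s) (f : ℂ → ℂ)
    (θ : ℝ) {ℓ : ℝ} (hℓ : ℓ ∈ Ioc (0 : ℝ) 1) :
    ∫⁻ u in unitDisk ∩ Metric.closedBall (Complex.exp (θ * Complex.I)) (8 * ℓ),
      energyDensity p s f u ≤
      ENNReal.ofReal (Real.pi * 9 ^ (2 * s) * 2 ^ s) * ENNReal.ofReal (ℓ ^ s) *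
        seminormF p (p - 2) s f ^ p := by
  have hζ : ‖Complex.exp (θ * Complex.I)‖ = 1 := Complex.norm_exp_ofReal_mul_I θ
  set ζ := Complex.exp (θ * Complex.I)
  have hn := norm_radialPoint hℓ.2 hζ
  have hℓ0 := hℓ.1
  have ha : radialPoint ℓ ζ ∈ unitDisk := by rw [mem_ball_zero_iff, hn]; linarith
  have h := setLIntegral_energyDensity_le hp hs f ha (M := 9)
    (S := unitDisk ∩ Metric.closedBall ζ (8 * ℓ))
    (measurableSet_ball.inter measurableSet_closedBall) inter_subset_left (fun u hu => by
      have hu1 := mem_ball_zero_iff.1 hu.1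
      have hu2 := mem_closedBall_iff_norm.1 hu.2
      have e : 1 - (starRingEnd ℂ) (radialPoint ℓ ζ) * u =
          (1 - (starRingEnd ℂ) ζ * u) + (ℓ : ℂ) * ((starRingEnd ℂ) ζ * u) := by
        rw [radialPoint, map_mul, Complex.conj_ofReal]; push_cast; ring
      have h1 := norm_one_sub_conj_mul_le ζ u hζ.le
      rw [hζ, norm_sub_rev ζ u] at h1
      have h2 : ‖(ℓ : ℂ) * ((starRingEnd ℂ) ζ * u)‖ ≤ ℓ := by
        rw [norm_mul, norm_mul, RCLike.norm_conj, hζ, one_mul, Complex.norm_real,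
          Real.norm_of_nonneg hℓ0.le]
        nlinarith [norm_nonneg u]
      rw [e, hn]
      refine (norm_add_le _ _).trans ?_
      nlinarith [hℓ.2])
  refine h.trans ?_
  rw [hn, ← ENNReal.ofReal_mul (by positivity)]
  gcongr ENNReal.ofReal ?_ * _
  rw [mul_assoc (Real.pi * 9 ^ (2 * s)), ← Real.mul_rpow (by norm_num) hℓ0.le]
  have : 0 ≤ 1 - (1 - ℓ) ^ 2 := by nlinarith [hℓ.2]
  gcongr
  nlinarith

/-- Embedding estimate: a bound `c` on the logarithmic Carleson ratios of `μ` gives the bound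
`O(c)` for the `p`-th power of the norm of the embedding. -/
theorem exists_setLIntegral_carlesonBox_le {p s : ℝ} (hp : 0 < p) (hs : 0 < s) :
    ∃ C : ℝ≥0, ∀ (μ : Measure unitDisk) (c : ℝ≥0),
      (∀ θ : ℝ, ∀ ℓ ∈ Ioc (0 : ℝ) 1, logCarlesonRatio p s μ θ ℓ ≤ c) →
      ∀ f ∈ spaceF p (p - 2) s, ∀ θ : ℝ, ∀ ℓ ∈ Ioc (0 : ℝ) 1,
        ENNReal.ofReal (ℓ ^ (-s)) * ∫⁻ z in carlesonBox θ ℓ, ‖embedding f z‖ₑ ^ p ∂μ ≤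
          C * c * normF p (p - 2) s f ^ p := by
  obtain ⟨C₁, hC₁⟩ := exists_enorm_radialPoint_le hp hs
  obtain ⟨C₂, hC₂⟩ := exists_enorm_sub_radialPoint_rpow_le hp hs
  set B₁ : ℝ≥0 := C₁ ^ p * Real.toNNReal (2 ^ p) with hB₁
  set B₂ : ℝ≥0 := C₂ * Real.toNNReal (6 ^ p * 4 ^ s) * 3 *
    Real.toNNReal (Real.pi * 9 ^ (2 * s) * 2 ^ s) with hB₂
  refine ⟨Real.toNNReal (2 ^ p) * (B₁ + B₂), fun μ c hμ f hf θ ℓ hℓ => ?_⟩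
  have hℓ0 := hℓ.1
  have hL := log_two_div_pos hℓ
  -- The starting height `2^(-J)` is at least `ℓ`, so every point of the box lies beyond it, and
  -- less than `2ℓ`, so the disks used stay near the arc.
  obtain ⟨J, hJ1, hJ2⟩ : ∃ J : ℕ, (1 / 2 : ℝ) ^ (J + 1) < ℓ ∧ ℓ ≤ (1 / 2) ^ J :=
    exists_nat_pow_near_of_lt_one hℓ.1 hℓ.2 (by norm_num) (by norm_num)
  have hJ1' : (1 / 2 : ℝ) ^ J ≤ 2 * ℓ := by rw [pow_succ] at hJ1; linarith
  set N := normF p (p - 2) s f with hN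
  have hNs : seminormF p (p - 2) s f ≤ N := le_add_left le_rfl
  set T : ℕ → unitDisk → ℝ≥0∞ := fun j z => if J ≤ j then
    ((j : ℝ≥0∞) + 1) ^ p * ENNReal.ofReal (((1 / 2) ^ j) ^ (-s)) *
      ∫⁻ u, (radialRegion j).indicator (fun q => energyDensity p s f q.2) ((z : ℂ), u) else 0 with hT
  have hTm : ∀ j, Measurable (T j) := by
    intro j
    by_cases hj : J ≤ j
    · simp only [hT, if_pos hj]
      have h1 : Measurable ((radialRegion j).indicator (fun q => energyDensity p s f q.2)) :=
        ((measurable_energyDensity p s f).comp measurable_snd).indicator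
          (measurableSet_radialRegion j)
      exact (h1.lintegral_prod_right'.comp measurable_subtype_coe).const_mul _
    · simp only [hT, if_neg hj]; exact measurable_const
  set A : ℝ≥0∞ := (C₁ * (J + 1) * N) ^ p with hA
  have hpt : ∀ z ∈ carlesonBox θ ℓ, ‖embedding f z‖ₑ ^ p ≤
      ENNReal.ofReal (2 ^ p) * (A + C₂ * ∑' j, T j z) := by
    intro z hz
    have hz0 := norm_pos_of_mem_carlesonBox hz
    have hω : ‖(z : ℂ) / (‖(z : ℂ)‖ : ℂ)‖ = 1 := by
      rw [norm_div, Complex.norm_real, norm_norm, div_self hz0.ne']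
    have h1 := hC₁ f hf _ hω J
    have h2 := hC₂ f hf z z.2 J (by linarith [hz.1])
    set w := f (radialPoint ((1 / 2) ^ J) ((z : ℂ) / (‖(z : ℂ)‖ : ℂ)))
    have h3 : ‖embedding f z‖ₑ ≤ ‖w‖ₑ + ‖f z - w‖ₑ := by
      refine le_trans (le_of_eq ?_) (enorm_add_le _ _)
      rw [embedding, add_sub_cancel]
    have h4 : (‖w‖ₑ + ‖f z - w‖ₑ) ^ p ≤ ENNReal.ofReal (2 ^ p) * (‖w‖ₑ ^ p + ‖f z - w‖ₑ ^ p) := by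
      have h2p : ENNReal.ofReal (2 ^ p) = 2 ^ p := by
        rw [← ENNReal.ofReal_rpow_of_nonneg (by norm_num) hp.le]; simp
      rw [h2p]
      have hmax : ‖w‖ₑ + ‖f z - w‖ₑ ≤ 2 * max ‖w‖ₑ ‖f z - w‖ₑ := by
        rw [two_mul]
        exact add_le_add (le_max_left _ _) (le_max_right _ _)
      calc _ ≤ (2 * max ‖w‖ₑ ‖f z - w‖ₑ) ^ p := by gcongr
        _ = 2 ^ p * (max ‖w‖ₑ ‖f z - w‖ₑ) ^ p := ENNReal.mul_rpow_of_nonneg _ _ hp.le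
        _ ≤ _ := by
          gcongr
          rcases le_total ‖w‖ₑ ‖f z - w‖ₑ with h | h
          · rw [max_eq_right h]; exact le_add_self
          · rw [max_eq_left h]; exact le_self_add
    calc _ ≤ (‖w‖ₑ + ‖f z - w‖ₑ) ^ p := by gcongr
      _ ≤ _ := h4
      _ ≤ _ := mul_le_mul_right (add_le_add (ENNReal.rpow_le_rpow h1 hp.le) h2) _
  have hmain : ∀ j, ∫⁻ z in carlesonBox θ ℓ, T j z ∂μ ≤
      ENNReal.ofReal (6 ^ p * 4 ^ s) * c * ∫⁻ u in unitDisk ∩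
        Metric.closedBall (Complex.exp (θ * Complex.I)) (8 * ℓ),
        (dyadicAnnulus j).indicator (energyDensity p s f) u := by
    intro j
    by_cases hj : J ≤ j
    · simp only [hT, if_pos hj]
      rw [lintegral_const_mul' _ _ (by finiteness)]
      exact lintegral_radialRegion_le hp hs hμ hℓ hJ1' hj f
    · simp only [hT, if_neg hj, lintegral_zero]; exact zero_le
  have hsum : ∫⁻ z in carlesonBox θ ℓ, ∑' j, T j z ∂μ ≤
      ENNReal.ofReal (6 ^ p * 4 ^ s) * c * (3 * (ENNReal.ofReal (Real.pi * 9 ^ (2 * s) * 2 ^ s) *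
        ENNReal.ofReal (ℓ ^ s) * N ^ p)) := by
    rw [lintegral_tsum fun j => (hTm j).aemeasurable]
    refine (ENNReal.tsum_le_tsum hmain).trans ?_
    rw [ENNReal.tsum_mul_left, ← lintegral_tsum fun j =>
      ((measurable_energyDensity p s f).indicator (measurableSet_dyadicAnnulus j)).aemeasurable]
    gcongr
    calc _ ≤ ∫⁻ u in unitDisk ∩ Metric.closedBall (Complex.exp (θ * Complex.I)) (8 * ℓ),
          3 * energyDensity p s f u :=
          lintegral_mono fun u => tsum_indicator_dyadicAnnulus_le _ u
      _ = 3 * _ := lintegral_const_mul' _ _ (by finiteness)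
      _ ≤ _ := by
        gcongr
        refine (setLIntegral_energyDensity_arc_le hp hs f θ hℓ).trans ?_
        gcongr
  have hbox : A * μ (carlesonBox θ ℓ) ≤
      (C₁ : ℝ≥0∞) ^ p * ENNReal.ofReal (2 ^ p) * c * ENNReal.ofReal (ℓ ^ s) * N ^ p := by
    -- From `2^(J+1) ≤ 2/ℓ` and `2 log 2 > 1`; the growth bound at the starting point is thus
    -- matched by the logarithm of the Carleson condition.
    have hJL : (J : ℝ) + 1 ≤ 2 * Real.log (2 / ℓ) := by
      have hl2 := Real.log_two_gt_d9
      have : ((J + 1 : ℕ) : ℝ) * Real.log 2 ≤ Real.log (2 / ℓ) := by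
        rw [← Real.log_pow]
        refine Real.log_le_log (by positivity) ?_
        rw [le_div_iff₀ hℓ0]
        calc (2 : ℝ) ^ (J + 1) * ℓ ≤ 2 ^ (J + 1) * (1 / 2) ^ J := by gcongr
          _ = 2 := by rw [one_div, inv_pow, pow_succ]; field_simp
      push_cast at this
      nlinarith [(Nat.cast_nonneg J : (0 : ℝ) ≤ J)]
    have hJE : ((J : ℝ≥0∞) + 1) ^ p = ENNReal.ofReal (((J : ℝ) + 1) ^ p) := by
      rw [← ENNReal.ofReal_rpow_of_nonneg (by positivity) hp.le,
        ENNReal.ofReal_add (by positivity) (by positivity)]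
      simp
    have hJp : ((J : ℝ) + 1) ^ p * (ℓ ^ s * Real.log (2 / ℓ) ^ (-p)) ≤ 2 ^ p * ℓ ^ s := by
      calc _ ≤ (2 * Real.log (2 / ℓ)) ^ p * (ℓ ^ s * Real.log (2 / ℓ) ^ (-p)) := by gcongr
        _ = 2 ^ p * ℓ ^ s * (Real.log (2 / ℓ) ^ p * Real.log (2 / ℓ) ^ (-p)) := by
            rw [Real.mul_rpow (by norm_num) hL.le]; ring
        _ = _ := by rw [← Real.rpow_add hL]; simp
    calc A * μ (carlesonBox θ ℓ)
        ≤ (C₁ ^ p * ENNReal.ofReal (((J : ℝ) + 1) ^ p) * N ^ p) *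
          (c * ENNReal.ofReal (ℓ ^ s * Real.log (2 / ℓ) ^ (-p))) := by
          rw [hA, ENNReal.mul_rpow_of_nonneg _ _ hp.le, ENNReal.mul_rpow_of_nonneg _ _ hp.le, hJE]
          gcongr
          exact measure_carlesonBox_le hℓ (hμ θ ℓ hℓ)
      _ = C₁ ^ p * c * N ^ p * ENNReal.ofReal (((J : ℝ) + 1) ^ p *
            (ℓ ^ s * Real.log (2 / ℓ) ^ (-p))) := by
          rw [ENNReal.ofReal_mul (p := ((J : ℝ) + 1) ^ p) (by positivity)]; ring
      _ ≤ C₁ ^ p * c * N ^ p * ENNReal.ofReal (2 ^ p * ℓ ^ s) := by gcongr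
      _ = _ := by rw [ENNReal.ofReal_mul (by positivity)]; ring
  have hfinal : ∫⁻ z in carlesonBox θ ℓ, ‖embedding f z‖ₑ ^ p ∂μ ≤
      ENNReal.ofReal (2 ^ p) * ((B₁ + B₂) * c * ENNReal.ofReal (ℓ ^ s) * N ^ p) := by
    calc _ ≤ ∫⁻ z in carlesonBox θ ℓ, ENNReal.ofReal (2 ^ p) * (A + C₂ * ∑' j, T j z) ∂μ :=
          setLIntegral_mono' (measurableSet_carlesonBox θ ℓ) hpt
      _ = ENNReal.ofReal (2 ^ p) * (A * μ (carlesonBox θ ℓ) +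
            C₂ * ∫⁻ z in carlesonBox θ ℓ, ∑' j, T j z ∂μ) := by
          rw [lintegral_const_mul' _ _ ENNReal.ofReal_ne_top, lintegral_add_left measurable_const,
            setLIntegral_const, lintegral_const_mul' _ _ ENNReal.coe_ne_top]
      _ ≤ _ := mul_le_mul_right (add_le_add hbox (mul_le_mul_right hsum _)) _
      _ = _ := by
          rw [hB₁, hB₂]
          push_cast
          rw [ENNReal.coe_rpow_of_nonneg _ hp.le]
          simp only [ENNReal.ofReal]
          ring
  calc _ ≤ ENNReal.ofReal (ℓ ^ (-s)) *
        (ENNReal.ofReal (2 ^ p) * ((B₁ + B₂) * c * ENNReal.ofReal (ℓ ^ s) * N ^ p)) := by gcongr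
    _ = (ENNReal.ofReal (ℓ ^ (-s)) * ENNReal.ofReal (ℓ ^ s)) *
        (ENNReal.ofReal (2 ^ p) * (B₁ + B₂) * c * N ^ p) := by ring
    _ = _ := by
        rw [← ENNReal.ofReal_mul (by positivity), ← Real.rpow_add hℓ0]
        simp [ENNReal.ofReal]

/-! ### Logarithmic test functions -/

theorem normT_rpow {p : ℝ} (hp : 0 < p) (s : ℝ) (μ : Measure unitDisk) (g : unitDisk → ℂ) :
    normT p s μ g ^ p = ⨆ (θ : ℝ) (ℓ : ℝ) (_ : ℓ ∈ Ioc (0 : ℝ) 1),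
      ENNReal.ofReal (ℓ ^ (-s)) * ∫⁻ z in carlesonBox θ ℓ, ‖g z‖ₑ ^ p ∂μ := by
  rw [normT, ← ENNReal.rpow_mul, one_div_mul_cancel hp.ne', ENNReal.rpow_one]

theorem normT_rpow_le_iff {p : ℝ} (hp : 0 < p) {s : ℝ} {μ : Measure unitDisk}
    {g : unitDisk → ℂ} {B : ℝ≥0∞} :
    normT p s μ g ^ p ≤ B ↔ ∀ θ : ℝ, ∀ ℓ ∈ Ioc (0 : ℝ) 1,
      ENNReal.ofReal (ℓ ^ (-s)) * ∫⁻ z in carlesonBox θ ℓ, ‖g z‖ₑ ^ p ∂μ ≤ B := by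
  rw [normT_rpow hp]
  simp only [iSup_le_iff]

theorem logCarlesonRatio_le_normT {p : ℝ} (hp : 0 < p) {s : ℝ} {μ : Measure unitDisk}
    {g : unitDisk → ℂ} {θ ℓ : ℝ} (hℓ : ℓ ∈ Ioc (0 : ℝ) 1)
    (hg : ∀ z ∈ carlesonBox θ ℓ, Real.log (2 / ℓ) ≤ ‖g z‖) :
    logCarlesonRatio p s μ θ ℓ ≤ normT p s μ g ^ p := by
  have hL := log_two_div_pos hℓ
  have hℓ0 := hℓ.1
  refine le_trans ?_ ((normT_rpow_le_iff hp).1 le_rfl θ ℓ hℓ)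
  rw [logCarlesonRatio, one_div, ← Real.rpow_neg hℓ0.le, ENNReal.ofReal_mul (by positivity),
    mul_assoc, ← setLIntegral_const]
  gcongr ENNReal.ofReal (ℓ ^ (-s)) * ?_
  refine setLIntegral_mono' (measurableSet_carlesonBox θ ℓ) fun z hz => ?_
  rw [← ofReal_norm, ENNReal.ofReal_rpow_of_nonneg (norm_nonneg _) hp.le]
  have := hg z hz
  gcongr

/-- The logarithmic test function `log 12 - log (1 - conj a * z)`. -/
noncomputable def logKernel (a z : ℂ) : ℂ :=
  (Real.log 12 : ℂ) - Complex.log (1 - (starRingEnd ℂ) a * z)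

theorem one_sub_conj_mul_mem_slitPlane {a z : ℂ} (ha : a ∈ unitDisk) (hz : z ∈ unitDisk) :
    1 - (starRingEnd ℂ) a * z ∈ Complex.slitPlane := by
  rw [mem_ball_zero_iff] at ha hz
  refine Complex.mem_slitPlane_of_norm_lt_one (z := -((starRingEnd ℂ) a * z)) ?_
  rw [norm_neg, norm_mul, RCLike.norm_conj]
  nlinarith [norm_nonneg a, norm_nonneg z]

theorem hasDerivAt_logKernel {a z : ℂ} (ha : a ∈ unitDisk) (hz : z ∈ unitDisk) :
    HasDerivAt (logKernel a) ((starRingEnd ℂ) a / (1 - (starRingEnd ℂ) a * z)) z := by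
  have h1 : HasDerivAt (fun z => 1 - (starRingEnd ℂ) a * z) (-((starRingEnd ℂ) a * 1)) z :=
    ((hasDerivAt_id z).const_mul _).const_sub 1
  have h2 := (h1.clog (one_sub_conj_mul_mem_slitPlane ha hz)).const_sub (Real.log 12 : ℂ)
  refine h2.congr_deriv ?_
  rw [mul_one, neg_div, neg_neg]

theorem logKernel_re (a z : ℂ) :
    (logKernel a z).re = Real.log 12 - Real.log ‖1 - (starRingEnd ℂ) a * z‖ := by
  rw [logKernel, Complex.sub_re, Complex.ofReal_re, Complex.log_re]

theorem norm_logKernel_le {a z : ℂ} (ha : a ∈ unitDisk) (hz : z ∈ unitDisk) {δ : ℝ} (hδ : 0 < δ)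
    (h : δ ≤ ‖1 - (starRingEnd ℂ) a * z‖) : ‖logKernel a z‖ ≤ Real.log (12 / δ) + Real.pi := by
  rw [mem_ball_zero_iff] at ha hz
  have h2 : ‖1 - (starRingEnd ℂ) a * z‖ ≤ 12 := by
    refine (norm_sub_le _ _).trans ?_
    rw [norm_one, norm_mul, RCLike.norm_conj]
    nlinarith [norm_nonneg a, norm_nonneg z]
  refine (Complex.norm_le_abs_re_add_abs_im _).trans (add_le_add ?_ ?_)
  · rw [logKernel_re, abs_of_nonneg (sub_nonneg.2 (Real.log_le_log (hδ.trans_le h) h2)),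
      Real.log_div (by norm_num) hδ.ne']
    have := Real.log_le_log hδ h
    linarith
  · rw [logKernel, Complex.sub_im, Complex.ofReal_im, zero_sub, abs_neg, Complex.log_im]
    exact Complex.abs_arg_le_pi _

/-- On the box `|1 - conj a z| ≤ |ζ - z| + ℓ ≤ (π + 2) ℓ ≤ 6ℓ`, so the real part is at least `log
(12 / (6ℓ))`; this explains the constant `12`. -/
theorem log_two_div_le_norm_logKernel {θ ℓ : ℝ} (hℓ : ℓ ∈ Ioc (0 : ℝ) 1) {z : unitDisk}
    (hz : z ∈ carlesonBox θ ℓ) :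
    Real.log (2 / ℓ) ≤ ‖logKernel (radialPoint ℓ (Complex.exp (θ * Complex.I))) z‖ := by
  have hζ : ‖Complex.exp (θ * Complex.I)‖ = 1 := Complex.norm_exp_ofReal_mul_I θ
  have h1 := norm_div_norm_sub_le_of_mem_carlesonBox hz
  have hz0 := norm_pos_of_mem_carlesonBox hz
  have hz1 := hz.2.1
  have hzℓ := hz.1
  set ζ := Complex.exp (θ * Complex.I)
  have hℓ0 := hℓ.1
  have hn := norm_radialPoint hℓ.2 hζ
  have hpos := norm_one_sub_conj_mul_pos (a := radialPoint ℓ ζ) (by rw [hn]; linarith) hz1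
  have hle : ‖1 - (starRingEnd ℂ) (radialPoint ℓ ζ) * z‖ ≤ 6 * ℓ := by
    have e : 1 - (starRingEnd ℂ) (radialPoint ℓ ζ) * z =
        (1 - (starRingEnd ℂ) ζ * z) + (ℓ : ℂ) * ((starRingEnd ℂ) ζ * z) := by
      rw [radialPoint, map_mul, Complex.conj_ofReal]; push_cast; ring
    have h2 := norm_one_sub_conj_mul_le ζ z hζ.le
    rw [hζ] at h2
    have h3 : ‖(ℓ : ℂ) * ((starRingEnd ℂ) ζ * z)‖ ≤ ℓ := by
      rw [norm_mul, norm_mul, RCLike.norm_conj, hζ, one_mul, Complex.norm_real,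
        Real.norm_of_nonneg hℓ0.le]
      nlinarith
    have h4 : ‖(z : ℂ) - (z : ℂ) / (‖(z : ℂ)‖ : ℂ)‖ = 1 - ‖(z : ℂ)‖ := by
      have hne : (‖(z : ℂ)‖ : ℂ) ≠ 0 := by exact_mod_cast hz0.ne'
      have : (z : ℂ) - (z : ℂ) / (‖(z : ℂ)‖ : ℂ) =
          ((‖(z : ℂ)‖ - 1 : ℝ) : ℂ) * ((z : ℂ) / (‖(z : ℂ)‖ : ℂ)) := by
        push_cast; field_simp
      rw [this, norm_mul, norm_div, Complex.norm_real, Complex.norm_real, norm_norm,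
        div_self hz0.ne', mul_one, Real.norm_eq_abs, abs_of_neg (by linarith)]
      ring
    have h5 := norm_sub_le_norm_sub_add_norm_sub ζ ((z : ℂ) / (‖(z : ℂ)‖ : ℂ)) z
    rw [norm_sub_rev ζ ((z : ℂ) / (‖(z : ℂ)‖ : ℂ)),
      norm_sub_rev ((z : ℂ) / (‖(z : ℂ)‖ : ℂ)) z, h4] at h5
    rw [e]
    refine (norm_add_le _ _).trans ?_
    have := Real.pi_le_four
    nlinarith
  refine le_trans ?_ (Complex.re_le_norm _)
  rw [logKernel_re, ← Real.log_div (by norm_num) hpos.ne']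
  refine Real.log_le_log (by positivity) ?_
  rw [div_le_div_iff₀ hℓ0 hpos]
  linarith

theorem exists_seminormF_le {p s : ℝ} (hs : 0 < s) (hp : 0 < p) (hsp : 1 < s + p) :
    ∃ C : ℝ≥0, ∀ a ∈ unitDisk, ∀ (f : ℂ → ℂ) (B : ℝ), 0 ≤ B →
      (∀ z ∈ unitDisk, ‖deriv f z‖ ≤ B * ‖1 - (starRingEnd ℂ) a * z‖⁻¹) →
      seminormF p (p - 2) s f ≤ C * ENNReal.ofReal B := by
  obtain ⟨C, hC⟩ := exists_lintegral_moebius_weight_le hs hp hsp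
  refine ⟨((Real.toNNReal Real.pi)⁻¹ * C) ^ (1 / p), fun a ha f B hB hf => ?_⟩
  have hpi : Real.toNNReal Real.pi ≠ 0 := by simpa using Real.pi_pos
  rw [← ENNReal.rpow_le_rpow_iff hp, seminormF_rpow hp, ENNReal.mul_rpow_of_nonneg _ _ hp.le,
    ENNReal.coe_rpow_of_nonneg _ (by positivity), ← ENNReal.rpow_mul, one_div_mul_cancel hp.ne',
    ENNReal.rpow_one, ENNReal.ofReal_rpow_of_nonneg hB hp.le, ENNReal.coe_mul,
    ENNReal.coe_inv hpi, mul_assoc]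
  refine iSup₂_le fun b hb => mul_le_mul_right ?_ _
  calc _ ≤ ∫⁻ z in unitDisk, ENNReal.ofReal (B ^ p) * ENNReal.ofReal ((1 - ‖z‖ ^ 2) ^ (p - 2) *
        (1 - ‖moebius b z‖ ^ 2) ^ s * ‖1 - (starRingEnd ℂ) a * z‖ ^ (-p)) := by
        refine setLIntegral_mono' measurableSet_ball fun z hz => ?_
        have hz' := mem_ball_zero_iff.1 hz
        have hx := norm_one_sub_conj_mul_pos (mem_ball_zero_iff.1 ha).le hz'
        have h1 : ‖deriv f z‖ ^ p ≤ B ^ p * ‖1 - (starRingEnd ℂ) a * z‖ ^ (-p) := by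
          rw [Real.rpow_neg hx.le, ← Real.inv_rpow hx.le, ← Real.mul_rpow hB (by positivity)]
          exact Real.rpow_le_rpow (norm_nonneg _) (hf z hz) hp.le
        have hw : 0 ≤ (1 - ‖z‖ ^ 2) ^ (p - 2) * (1 - ‖moebius b z‖ ^ 2) ^ s := by
          have hb' := mem_ball_zero_iff.1 hb
          have h2 : 0 < 1 - ‖z‖ ^ 2 := by nlinarith [norm_nonneg z]
          have h3 : 0 < 1 - ‖b‖ ^ 2 := by nlinarith [norm_nonneg b]
          rw [one_sub_norm_moebius_sq hb'.le hz']
          positivity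
        rw [← ofReal_norm, ENNReal.ofReal_rpow_of_nonneg (norm_nonneg _) hp.le,
          ← ENNReal.ofReal_mul (by positivity), ← ENNReal.ofReal_mul (by positivity)]
        refine ENNReal.ofReal_le_ofReal ?_
        calc _ ≤ (B ^ p * ‖1 - (starRingEnd ℂ) a * z‖ ^ (-p)) *
              ((1 - ‖z‖ ^ 2) ^ (p - 2) * (1 - ‖moebius b z‖ ^ 2) ^ s) := by gcongr
          _ = _ := by ring
    _ ≤ ENNReal.ofReal (B ^ p) * C := by
        rw [lintegral_const_mul' _ _ ENNReal.ofReal_ne_top]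
        gcongr
        exact hC a ha b hb
    _ = _ := mul_comm _ _

theorem radialPoint_exp_mem {ℓ : ℝ} (hℓ : ℓ ∈ Ioc (0 : ℝ) 1) (θ : ℝ) :
    radialPoint ℓ (Complex.exp (θ * Complex.I)) ∈ unitDisk := by
  rw [mem_ball_zero_iff, norm_radialPoint hℓ.2 (Complex.norm_exp_ofReal_mul_I θ)]
  linarith [hℓ.1]

theorem logKernel_zero (a : ℂ) : logKernel a 0 = (Real.log 12 : ℂ) := by simp [logKernel]

theorem exists_logKernel_mem_spaceF {p s : ℝ} (hs : 0 < s) (hp : 0 < p) (hsp : 1 < s + p) :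
    ∃ M : ℝ≥0, ∀ a ∈ unitDisk,
      logKernel a ∈ spaceF p (p - 2) s ∧ normF p (p - 2) s (logKernel a) ≤ M := by
  obtain ⟨C, hC⟩ := exists_seminormF_le hs hp hsp
  refine ⟨Real.toNNReal (Real.log 12) + C, fun a ha => ?_⟩
  have h := hC a ha (logKernel a) 1 zero_le_one (fun z hz => by
    rw [(hasDerivAt_logKernel ha hz).deriv, norm_div, RCLike.norm_conj, div_eq_mul_inv]
    gcongr
    exact (mem_ball_zero_iff.1 ha).le)
  rw [ENNReal.ofReal_one, mul_one] at h
  refine ⟨⟨fun z hz => (hasDerivAt_logKernel ha hz).differentiableAt.differentiableWithinAt,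
    h.trans_lt ENNReal.coe_lt_top⟩, ?_⟩
  rw [normF, logKernel_zero, ENNReal.coe_add, ← ofReal_norm, Complex.norm_real,
    Real.norm_of_nonneg (Real.log_nonneg (by norm_num))]
  exact add_le_add le_rfl h

/-- The normalized squares of the logarithmic test functions. -/
noncomputable def logKernelSq (θ ℓ : ℝ) (z : ℂ) : ℂ :=
  logKernel (radialPoint ℓ (Complex.exp (θ * Complex.I))) z ^ 2 / (Real.log (2 / ℓ) : ℂ)

theorem norm_logKernelSq {θ ℓ : ℝ} (hℓ : ℓ ∈ Ioc (0 : ℝ) 1) (z : ℂ) :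
    ‖logKernelSq θ ℓ z‖ =
      ‖logKernel (radialPoint ℓ (Complex.exp (θ * Complex.I))) z‖ ^ 2 / Real.log (2 / ℓ) := by
  rw [logKernelSq, norm_div, norm_pow, Complex.norm_real,
    Real.norm_of_nonneg (log_two_div_pos hℓ).le]

theorem exists_logKernelSq_mem_spaceF {p s : ℝ} (hs : 0 < s) (hp : 0 < p) (hsp : 1 < s + p) :
    ∃ M : ℝ≥0, ∀ θ : ℝ, ∀ ℓ ∈ Ioc (0 : ℝ) 1,
      logKernelSq θ ℓ ∈ spaceF p (p - 2) s ∧ normF p (p - 2) s (logKernelSq θ ℓ) ≤ M := by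
  obtain ⟨C, hC⟩ := exists_seminormF_le hs hp hsp
  refine ⟨Real.toNNReal (Real.log 12 ^ 2 / Real.log 2) + C * Real.toNNReal 30,
    fun θ ℓ hℓ => ?_⟩
  have ha := radialPoint_exp_mem hℓ θ
  have hn := norm_radialPoint hℓ.2 (Complex.norm_exp_ofReal_mul_I θ)
  set a := radialPoint ℓ (Complex.exp (θ * Complex.I)) with hadef
  have hL := log_two_div_pos hℓ
  have hℓ0 := hℓ.1
  have hl2 := Real.log_two_gt_d9
  have hL2 : Real.log 2 ≤ Real.log (2 / ℓ) := by
    refine Real.log_le_log (by norm_num) ?_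
    rw [le_div_iff₀ hℓ0]
    linarith [hℓ.2]
  have hder : ∀ z ∈ unitDisk, HasDerivAt (logKernelSq θ ℓ)
      ((2 * logKernel a z * ((starRingEnd ℂ) a / (1 - (starRingEnd ℂ) a * z))) /
        (Real.log (2 / ℓ) : ℂ)) z := by
    intro z hz
    refine (((hasDerivAt_logKernel ha hz).pow 2).div_const (Real.log (2 / ℓ) : ℂ)).congr_deriv ?_
    simp
  have h := hC a ha (logKernelSq θ ℓ) 30 (by norm_num) (fun z hz => by
    have hz' := mem_ball_zero_iff.1 hz
    have hx := norm_one_sub_conj_mul_pos (mem_ball_zero_iff.1 ha).le hz'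
    have hxℓ : ℓ ≤ ‖1 - (starRingEnd ℂ) a * z‖ := by
      have := one_sub_norm_le_norm_one_sub_conj_mul (a := z) (z := a) hz'.le
      rw [hn, norm_one_sub_conj_mul_comm] at this
      linarith
    have hk := norm_logKernel_le ha hz hℓ0 hxℓ
    -- The constants `log 6` and `π` are absorbed by `log (2/ℓ) ≥ log 2`. Differentiating the square
    -- doubles `15`, whence the `30`.
    have hk2 : ‖logKernel a z‖ ≤ 15 * Real.log (2 / ℓ) := by
      have e : 12 / ℓ = 6 * (2 / ℓ) := by ring
      have h6 := Real.log_le_sub_one_of_pos (by norm_num : (0 : ℝ) < 6)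
      have hpi := Real.pi_le_four
      rw [e, Real.log_mul (by norm_num) (by positivity)] at hk
      linarith
    rw [(hder z hz).deriv, norm_div, norm_mul, norm_mul, norm_div, RCLike.norm_conj,
      Complex.norm_real, Real.norm_of_nonneg hL.le, Complex.norm_two]
    have ha1 := (mem_ball_zero_iff.1 ha).le
    rw [div_le_iff₀ hL]
    calc 2 * ‖logKernel a z‖ * (‖a‖ / ‖1 - (starRingEnd ℂ) a * z‖)
        ≤ 2 * (15 * Real.log (2 / ℓ)) * (1 / ‖1 - (starRingEnd ℂ) a * z‖) := by gcongr
      _ = _ := by rw [one_div]; ring)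
  refine ⟨⟨fun z hz => (hder z hz).differentiableAt.differentiableWithinAt,
    h.trans_lt (ENNReal.mul_lt_top ENNReal.coe_lt_top ENNReal.ofReal_lt_top)⟩, ?_⟩
  rw [normF, ← ofReal_norm, norm_logKernelSq hℓ, logKernel_zero, Complex.norm_real,
    Real.norm_of_nonneg (Real.log_nonneg (by norm_num)), ENNReal.coe_add, ENNReal.coe_mul]
  refine add_le_add ?_ h
  rw [ENNReal.ofReal]
  gcongr

theorem log_two_div_le_norm_logKernelSq {θ ℓ : ℝ} (hℓ : ℓ ∈ Ioc (0 : ℝ) 1) {z : unitDisk}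
    (hz : z ∈ carlesonBox θ ℓ) : Real.log (2 / ℓ) ≤ ‖logKernelSq θ ℓ z‖ := by
  have hL := log_two_div_pos hℓ
  rw [norm_logKernelSq hℓ, le_div_iff₀ hL, ← sq]
  have := log_two_div_le_norm_logKernel hℓ hz
  gcongr

/-- On `|z| < r` one has `|1 - conj a z| ≥ 1 - r` for all `a` in the disk, so the numerators are
uniformly bounded while `log (2/ℓ n) → ∞`. -/
theorem tendstoUniformlyOn_logKernelSq {θ ℓ : ℕ → ℝ} (hℓ : ∀ n, ℓ n ∈ Ioc (0 : ℝ) 1)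
    (hℓ0 : Tendsto ℓ atTop (𝓝 0)) {K : Set ℂ} (hKD : K ⊆ unitDisk) (hK : IsCompact K) :
    TendstoUniformlyOn (fun n => logKernelSq (θ n) (ℓ n)) 0 atTop K := by
  obtain ⟨r, hr, hKr⟩ : ∃ r < 1, K ⊆ Metric.ball 0 r :=
    exists_lt_subset_ball hK.isClosed hKD
  have hr' : 0 < 1 - r := by linarith
  set B := Real.log (12 / (1 - r)) + Real.pi
  have hlim : Tendsto (fun n => B ^ 2 / Real.log (2 / ℓ n)) atTop (𝓝 0) := by
    refine Tendsto.div_atTop tendsto_const_nhds (Real.tendsto_log_atTop.comp ?_)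
    refine Tendsto.const_mul_atTop two_pos (Tendsto.inv_tendsto_nhdsGT_zero ?_)
    exact tendsto_nhdsWithin_iff.2 ⟨hℓ0, Eventually.of_forall fun n => (hℓ n).1⟩
  rw [Metric.tendstoUniformlyOn_iff]
  intro ε hε
  filter_upwards [hlim.eventually_lt_const hε] with n hn z hz
  rw [Pi.zero_apply, dist_zero_left, norm_logKernelSq (hℓ n)]
  refine lt_of_le_of_lt ?_ hn
  have hL := log_two_div_pos (hℓ n)
  have ha := radialPoint_exp_mem (hℓ n) (θ n)
  have hzr := mem_ball_zero_iff.1 (hKr hz)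
  have h1 := one_sub_norm_le_norm_one_sub_conj_mul (z := z) (mem_ball_zero_iff.1 ha).le
  have := norm_logKernel_le ha (hKD hz) hr' (by linarith)
  gcongr

/-! ### The boundedness criterion and the necessity of the vanishing condition -/

theorem isLogCarleson_of_embeddingBounded {p s : ℝ} (hs : 0 < s) (hp : 0 < p) (hsp : 1 < s + p)
    {μ : Measure unitDisk} (h : EmbeddingBounded p (p - 2) s μ) : IsLogCarleson p s μ := by
  obtain ⟨C, hC⟩ := h
  obtain ⟨M, hM⟩ := exists_logKernel_mem_spaceF hs hp hsp
  refine ⟨(C * M) ^ p, fun θ ℓ hℓ => ?_⟩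
  obtain ⟨h1, h2⟩ := hM _ (radialPoint_exp_mem hℓ θ)
  refine (logCarlesonRatio_le_normT hp hℓ
    (g := embedding (logKernel (radialPoint ℓ (Complex.exp (θ * Complex.I)))))
    fun z hz => log_two_div_le_norm_logKernel hℓ hz).trans ?_
  rw [ENNReal.coe_rpow_of_nonneg _ hp.le, ENNReal.coe_mul]
  gcongr
  exact ((hC _ h1).2).trans (by gcongr)

theorem measurable_embedding {f : ℂ → ℂ} (hf : DifferentiableOn ℂ f unitDisk) :
    Measurable (embedding f) :=
  (continuousOn_iff_continuous_domRestrict.1 hf.continuousOn).measurable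

theorem normF_lt_top {p q s : ℝ} {f : ℂ → ℂ} (hf : f ∈ spaceF p q s) : normF p q s f < ∞ :=
  ENNReal.add_lt_top.2 ⟨enorm_lt_top, hf.2⟩

theorem embeddingBounded_of_isLogCarleson {p s : ℝ} (hs : 0 < s) (hp : 0 < p)
    {μ : Measure unitDisk} (h : IsLogCarleson p s μ) : EmbeddingBounded p (p - 2) s μ := by
  obtain ⟨c, hc⟩ := h
  obtain ⟨C, hC⟩ := exists_setLIntegral_carlesonBox_le hp hs
  refine ⟨(C * c) ^ (1 / p), fun f hf => ?_⟩
  have key : normT p s μ (embedding f) ≤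
      (((C * c) ^ (1 / p) : ℝ≥0) : ℝ≥0∞) * normF p (p - 2) s f := by
    rw [← ENNReal.rpow_le_rpow_iff hp, ENNReal.mul_rpow_of_nonneg _ _ hp.le,
      ENNReal.coe_rpow_of_nonneg _ (by positivity), ← ENNReal.rpow_mul,
      one_div_mul_cancel hp.ne', ENNReal.rpow_one, normT_rpow_le_iff hp, ENNReal.coe_mul]
    exact hC μ c hc f hf
  exact ⟨⟨(measurable_embedding hf.1).aemeasurable,
    key.trans_lt (ENNReal.mul_lt_top ENNReal.coe_lt_top (normF_lt_top hf))⟩, key⟩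

theorem isVanishingLogCarleson_of_embeddingNullSequences {p s : ℝ} (hs : 0 < s) (hp : 0 < p)
    (hsp : 1 < s + p) {μ : Measure unitDisk} (h : EmbeddingNullSequences p (p - 2) s μ) :
    IsVanishingLogCarleson p s μ := by
  obtain ⟨M, hM⟩ := exists_logKernelSq_mem_spaceF hs hp hsp
  rw [IsVanishingLogCarleson, ENNReal.tendsto_nhds_zero]
  by_contra! hcon
  obtain ⟨ε, hε, hfreq⟩ := hcon
  have hex : ∀ n : ℕ, ∃ ℓ θ : ℝ, ℓ ∈ Ioc (0 : ℝ) 1 ∧ ℓ < 1 / ((n : ℝ) + 1) ∧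
      ε < logCarlesonRatio p s μ θ ℓ := by
    intro n
    have hn : (0 : ℝ) < 1 / ((n : ℝ) + 1) := by positivity
    obtain ⟨ℓ, hℓ1, hℓ2⟩ := (hfreq.and_eventually (Ioo_mem_nhdsGT hn)).exists
    obtain ⟨θ, hθ⟩ := lt_iSup_iff.1 hℓ1
    refine ⟨ℓ, θ, ⟨hℓ2.1, hℓ2.2.le.trans ?_⟩, hℓ2.2, hθ⟩
    rw [div_le_one (by positivity)]
    linarith [(Nat.cast_nonneg n : (0 : ℝ) ≤ n)]
  choose ℓ θ hℓ hℓn hratio using hex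
  have hℓ0 : Tendsto ℓ atTop (𝓝 0) :=
    squeeze_zero (fun n => (hℓ n).1.le) (fun n => (hℓn n).le) tendsto_one_div_add_atTop_nhds_zero_nat
  have hlim := h (fun n => logKernelSq (θ n) (ℓ n)) (fun n => (hM _ _ (hℓ n)).1)
    ⟨M, fun n => (hM _ _ (hℓ n)).2⟩
    (fun K hKD hK => tendstoUniformlyOn_logKernelSq hℓ hℓ0 hKD hK)
  have hlim' : Tendsto (fun n => normT p s μ (embedding (logKernelSq (θ n) (ℓ n))) ^ p) atTop
      (𝓝 0) := by
    have := hlim.ennrpow_const p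
    rwa [ENNReal.zero_rpow_of_pos hp] at this
  obtain ⟨n, hn⟩ := (hlim'.eventually_lt_const hε).exists
  have := logCarlesonRatio_le_normT hp (s := s) (μ := μ) (hℓ n)
    (g := embedding (logKernelSq (θ n) (ℓ n))) fun z hz => log_two_div_le_norm_logKernelSq (hℓ n) hz
  exact absurd (hratio n) (not_lt.2 (this.trans hn.le))

/-! ### Sufficiency of the vanishing condition -/

theorem exists_mem_carlesonBox {N : ℕ} (hN : 0 < N) {z : unitDisk}
    (hz : 1 - 1 / (N : ℝ) < ‖(z : ℂ)‖) :
    ∃ k ∈ Finset.Icc (-(N : ℤ)) N, z ∈ carlesonBox (2 * Real.pi * k / N) (1 / N) := by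
  have hN' : (1 : ℝ) ≤ N := by exact_mod_cast hN
  have hpi := Real.pi_pos
  have hz0 : 0 < ‖(z : ℂ)‖ := by
    have : 1 / (N : ℝ) ≤ 1 := by rw [div_le_one (by linarith)]; exact hN'
    linarith
  set x : ℝ := Complex.arg z * N / (2 * Real.pi) with hx
  have hxarg : Complex.arg z = 2 * Real.pi * x / N := by rw [hx]; field_simp
  have hxN : |x| ≤ N / 2 := by
    rw [hx, abs_div, abs_mul, abs_of_pos (by positivity : 0 < 2 * Real.pi), Nat.abs_cast,
      div_le_iff₀ (by positivity)]
    have := Complex.abs_arg_le_pi z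
    nlinarith
  have hround := abs_sub_round x
  refine ⟨round x, ?_, hz, mem_ball_zero_iff.1 z.2, Complex.arg z, ?_, ?_⟩
  · rw [abs_le] at hround hxN
    rw [Finset.mem_Icc]
    constructor
    · have : (-(N : ℤ) : ℝ) ≤ round x := by push_cast; linarith
      exact_mod_cast this
    · have : (round x : ℝ) ≤ (N : ℤ) := by push_cast; linarith
      exact_mod_cast this
  · rw [hxarg, show 2 * Real.pi * x / N - 2 * Real.pi * round x / N =
      (2 * Real.pi / N) * (x - round x) by ring, abs_mul, abs_of_pos (by positivity)]
    calc 2 * Real.pi / N * |x - round x| ≤ 2 * Real.pi / N * (1 / 2) := by gcongr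
      _ = _ := by ring
  · have hne : (‖(z : ℂ)‖ : ℂ) ≠ 0 := by exact_mod_cast hz0.ne'
    rw [div_eq_iff hne, mul_comm]
    exact (Complex.norm_mul_exp_arg_mul_I _).symm

theorem isCompact_setOf_norm_le {r : ℝ} (hr : r < 1) :
    IsCompact {z : unitDisk | ‖(z : ℂ)‖ ≤ r} := by
  rw [Subtype.isCompact_iff]
  have : (Subtype.val '' {z : unitDisk | ‖(z : ℂ)‖ ≤ r}) = Metric.closedBall 0 r := by
    ext w
    simp only [mem_image, mem_closedBall_zero_iff]
    constructor
    · rintro ⟨z, hz, rfl⟩; exact hz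
    · intro hw
      exact ⟨⟨w, mem_ball_zero_iff.2 (hw.trans_lt hr)⟩, hw, rfl⟩
  rw [this]
  exact isCompact_closedBall _ _

theorem IsVanishingLogCarleson.exists_ratio_le {p s : ℝ} {μ : Measure unitDisk}
    (h : IsVanishingLogCarleson p s μ) {c : ℝ≥0∞} (hc : 0 < c) :
    ∃ ℓ₀ ∈ Ioc (0 : ℝ) 1, ∀ ℓ ∈ Ioo 0 ℓ₀, ∀ θ, logCarlesonRatio p s μ θ ℓ ≤ c := by
  have h1 := ENNReal.tendsto_nhds_zero.1 h c hc
  obtain ⟨u, hu, hsub⟩ := mem_nhdsGT_iff_exists_Ioo_subset.1 h1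
  refine ⟨min u 1, ⟨lt_min hu one_pos, min_le_right _ _⟩, fun ℓ hℓ θ => ?_⟩
  exact (le_iSup (fun θ => logCarlesonRatio p s μ θ ℓ) θ).trans
    (hsub ⟨hℓ.1, hℓ.2.trans_le (min_le_left _ _)⟩)

/-- The vanishing condition controls only short arcs. Finitely many short boxes cover an annulus at
the circle, and the remaining closed disk is compact. -/
theorem IsVanishingLogCarleson.measure_univ_lt_top {p s : ℝ} {μ : Measure unitDisk}
    (hμ : ∀ K : Set unitDisk, IsCompact K → μ K < ∞) (h : IsVanishingLogCarleson p s μ) :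
    μ univ < ∞ := by
  obtain ⟨ℓ₀, hℓ₀, hr⟩ := h.exists_ratio_le one_pos
  obtain ⟨n, hn⟩ := exists_nat_one_div_lt hℓ₀.1
  have hn' : 1 / ((n + 1 : ℕ) : ℝ) < ℓ₀ := by push_cast; exact hn
  have hpos : (0 : ℝ) < 1 / ((n + 1 : ℕ) : ℝ) := by positivity
  have hcover : (univ : Set unitDisk) ⊆ {z : unitDisk | ‖(z : ℂ)‖ ≤ 1 - 1 / ((n + 1 : ℕ) : ℝ)} ∪
      ⋃ k ∈ Finset.Icc (-((n + 1 : ℕ) : ℤ)) ((n + 1 : ℕ) : ℤ),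
        carlesonBox (2 * Real.pi * k / ((n + 1 : ℕ) : ℝ)) (1 / ((n + 1 : ℕ) : ℝ)) := by
    intro z _
    rcases le_or_gt ‖(z : ℂ)‖ (1 - 1 / ((n + 1 : ℕ) : ℝ)) with hz | hz
    · exact Or.inl hz
    · right
      obtain ⟨k, hk, hzk⟩ := exists_mem_carlesonBox n.succ_pos hz
      exact mem_iUnion₂.2 ⟨k, hk, hzk⟩
  refine (measure_mono hcover).trans_lt ((measure_union_le _ _).trans_lt ?_)
  refine ENNReal.add_lt_top.2 ⟨hμ _ (isCompact_setOf_norm_le (by linarith)), ?_⟩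
  refine measure_biUnion_lt_top (Finset.finite_toSet _) fun k _ => ?_
  refine (measure_carlesonBox_le (p := p) (s := s) (c := 1) ⟨hpos, hn'.le.trans hℓ₀.2⟩
    (hr _ ⟨hpos, hn'⟩ _)).trans_lt (ENNReal.mul_lt_top ENNReal.coe_lt_top ENNReal.ofReal_lt_top)

/-- Near the unit circle a vanishing logarithmic Carleson measure has small constant. -/
theorem IsVanishingLogCarleson.exists_restrict_ratio_le {p s : ℝ} (hp : 0 < p) (hs : 0 < s)
    {μ : Measure unitDisk} (hμ : μ univ < ∞) (h : IsVanishingLogCarleson p s μ) {c : ℝ≥0}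
    (hc : 0 < c) :
    ∃ r < 1, ∀ θ : ℝ, ∀ ℓ ∈ Ioc (0 : ℝ) 1,
      logCarlesonRatio p s (μ.restrict {z | r < ‖(z : ℂ)‖}) θ ℓ ≤ c := by
  obtain ⟨ℓ₀, hℓ₀, hr⟩ := h.exists_ratio_le (ENNReal.coe_pos.2 hc)
  set W : ℝ := 1 / ℓ₀ ^ s * Real.log (2 / ℓ₀) ^ p
  set S : ℕ → Set unitDisk := fun k => {z | 1 - 1 / ((k : ℝ) + 1) < ‖(z : ℂ)‖} with hS
  have hcoe : Measurable fun z : unitDisk => (z : ℂ) := measurable_subtype_coe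
  have hSm : ∀ k, MeasurableSet (S k) := fun k => measurableSet_lt measurable_const hcoe.norm
  have hlim : Tendsto (fun k => μ (S k)) atTop (𝓝 0) := by
    have hanti : Antitone S := by
      intro k m hkm z hz
      have h1 : 1 - 1 / ((m : ℝ) + 1) < ‖(z : ℂ)‖ := hz
      have h2 : 1 / ((m : ℝ) + 1) ≤ 1 / ((k : ℝ) + 1) := Nat.one_div_le_one_div hkm
      change 1 - 1 / ((k : ℝ) + 1) < ‖(z : ℂ)‖
      linarith
    have hempty : ⋂ k, S k = ∅ := by
      rw [eq_empty_iff_forall_notMem]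
      intro z hz
      obtain ⟨k, hk⟩ := exists_nat_one_div_lt (sub_pos.2 (mem_ball_zero_iff.1 z.2))
      have : 1 - 1 / ((k : ℝ) + 1) < ‖(z : ℂ)‖ := mem_iInter.1 hz k
      linarith
    have := tendsto_measure_iInter_atTop (fun k => (hSm k).nullMeasurableSet) hanti
      ⟨0, ((measure_mono (subset_univ _)).trans_lt hμ).ne⟩
    rwa [hempty, measure_empty] at this
  have hlimW : Tendsto (fun k => ENNReal.ofReal W * μ (S k)) atTop (𝓝 0) := by
    have := ENNReal.Tendsto.const_mul hlim (Or.inr (ENNReal.ofReal_ne_top (r := W)))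
    rwa [mul_zero] at this
  obtain ⟨k, hk⟩ := (hlimW.eventually_lt_const (ENNReal.coe_pos.2 hc)).exists
  refine ⟨1 - 1 / ((k : ℝ) + 1), by linarith [show (0 : ℝ) < 1 / ((k : ℝ) + 1) by positivity],
    fun θ ℓ hℓ => ?_⟩
  have hL := log_two_div_pos hℓ
  have hℓ0 := hℓ.1
  have hℓ₀0 := hℓ₀.1
  rcases lt_or_ge ℓ ℓ₀ with hlt | hge
  · refine le_trans ?_ (hr ℓ ⟨hℓ0, hlt⟩ θ)
    rw [logCarlesonRatio, logCarlesonRatio]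
    gcongr
    exact Measure.restrict_le_self
  -- For long arcs the weight is at most its value `W` at `ℓ₀`, and `k` was chosen so that the mass
  -- of the annulus times `W` is below `c`.
  · refine le_trans ?_ hk.le
    rw [logCarlesonRatio]
    gcongr ?_ * ?_
    · refine ENNReal.ofReal_le_ofReal ?_
      simp only [W]
      gcongr
    · refine (measure_mono (subset_univ _)).trans ?_
      rw [Measure.restrict_apply_univ]

theorem embeddingNullSequences_of_isVanishingLogCarleson {p s : ℝ} (hs : 0 < s) (hp : 0 < p)
    {μ : Measure unitDisk} (hμK : ∀ K : Set unitDisk, IsCompact K → μ K < ∞)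
    (h : IsVanishingLogCarleson p s μ) : EmbeddingNullSequences p (p - 2) s μ := by
  have hμ := h.measure_univ_lt_top hμK
  obtain ⟨C, hC⟩ := exists_setLIntegral_carlesonBox_le hp hs
  rintro f hf ⟨M, hM⟩ hunif
  suffices hlim : Tendsto (fun n => normT p s μ (embedding (f n)) ^ p) atTop (𝓝 0) by
    have := hlim.ennrpow_const (1 / p)
    rw [ENNReal.zero_rpow_of_pos (by positivity)] at this
    refine this.congr fun n => ?_
    rw [← ENNReal.rpow_mul, mul_one_div_cancel hp.ne', ENNReal.rpow_one]
  rw [ENNReal.tendsto_nhds_zero]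
  intro ε hε
  have hε2 : ε / 2 ≠ 0 := (ENNReal.half_pos hε.ne').ne'
  -- The linear dependence of the embedding estimate on the Carleson constant is used here: a small
  -- `c` makes the outer part at most `ε / 2` for all `n` at once.
  obtain ⟨c, hc, hcε⟩ := ENNReal.exists_nnreal_pos_mul_lt (a := (C * M ^ p : ℝ≥0))
    ENNReal.coe_ne_top hε2
  obtain ⟨r, hr1, hr⟩ := h.exists_restrict_ratio_le hp hs hμ hc
  set A : Set unitDisk := {z | r < ‖(z : ℂ)‖} with hA
  have hAm : MeasurableSet A := measurableSet_lt measurable_const measurable_subtype_coe.norm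
  have hr1' : 0 < 1 - r := by linarith
  set D : ℝ≥0∞ := ENNReal.ofReal ((1 - r) ^ (-s)) * μ univ with hD
  have hDfin : D ≠ ∞ := ENNReal.mul_ne_top ENNReal.ofReal_ne_top hμ.ne
  obtain ⟨η, hη, hηε⟩ := ENNReal.exists_nnreal_pos_mul_lt hDfin hε2
  have hη' : (0 : ℝ) < (η : ℝ) ^ (1 / p) := by positivity
  have hun := Metric.tendstoUniformlyOn_iff.1 (hunif (Metric.closedBall 0 r)
    (Metric.closedBall_subset_ball hr1) (isCompact_closedBall _ _)) _ hη'
  filter_upwards [hun] with n hn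
  rw [normT_rpow_le_iff hp]
  intro θ ℓ hℓ
  have h1 : ENNReal.ofReal (ℓ ^ (-s)) * ∫⁻ z in carlesonBox θ ℓ, ‖embedding (f n) z‖ₑ ^ p
      ∂(μ.restrict A) ≤ ε / 2 := by
    refine (hC (μ.restrict A) c hr (f n) (hf n) θ ℓ hℓ).trans (le_trans ?_ hcε.le)
    have hMn := hM n
    rw [ENNReal.coe_mul, ENNReal.coe_rpow_of_nonneg _ hp.le]
    calc _ ≤ (C : ℝ≥0∞) * c * (M : ℝ≥0∞) ^ p := by gcongr
      _ = _ := by ring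
  have h2 : ENNReal.ofReal (ℓ ^ (-s)) * ∫⁻ z in carlesonBox θ ℓ, ‖embedding (f n) z‖ₑ ^ p
      ∂(μ.restrict Aᶜ) ≤ ε / 2 := by
    refine le_trans ?_ hηε.le
    rw [Measure.restrict_restrict (measurableSet_carlesonBox θ ℓ)]
    -- Boxes with `ℓ ≤ 1 - r` miss the inner disk, so `ℓ^(-s)` is bounded wherever the inner part is
    -- nonzero.
    rcases le_or_gt ℓ (1 - r) with hle | hgt
    · have : carlesonBox θ ℓ ∩ Aᶜ = ∅ := by
        rw [eq_empty_iff_forall_notMem]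
        rintro z ⟨hz, hzA⟩
        exact hzA (lt_of_le_of_lt (by linarith) hz.1)
      rw [this]
      simp
    · have hbd : ∫⁻ z in carlesonBox θ ℓ ∩ Aᶜ, ‖embedding (f n) z‖ₑ ^ p ∂μ ≤ η * μ univ := by
        calc _ ≤ ∫⁻ z in carlesonBox θ ℓ ∩ Aᶜ, (η : ℝ≥0∞) ∂μ := by
              refine setLIntegral_mono' ((measurableSet_carlesonBox θ ℓ).inter hAm.compl) ?_
              rintro z ⟨-, hzA⟩
              have hz := hn z (mem_closedBall_zero_iff.2 (not_lt.1 hzA))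
              rw [Pi.zero_apply, dist_zero_left] at hz
              have h3 : ‖f n z‖ ^ p ≤ η := by
                calc ‖f n z‖ ^ p ≤ ((η : ℝ) ^ (1 / p)) ^ p := by gcongr
                  _ = η := by
                    rw [← Real.rpow_mul (by positivity), one_div_mul_cancel hp.ne', Real.rpow_one]
              rw [embedding, ← ofReal_norm, ENNReal.ofReal_rpow_of_nonneg (norm_nonneg _) hp.le,
                ← ENNReal.ofReal_coe_nnreal]
              exact ENNReal.ofReal_le_ofReal h3
          _ ≤ _ := by
              rw [setLIntegral_const]
              gcongr
              exact subset_univ _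
      have h4 : ℓ ^ (-s) ≤ (1 - r) ^ (-s) :=
        Real.rpow_le_rpow_of_nonpos hr1' hgt.le (by linarith)
      calc _ ≤ ENNReal.ofReal ((1 - r) ^ (-s)) * (η * μ univ) := by gcongr
        _ = _ := by rw [hD]; ring
  calc _ = ENNReal.ofReal (ℓ ^ (-s)) * (∫⁻ z in carlesonBox θ ℓ, ‖embedding (f n) z‖ₑ ^ p
          ∂(μ.restrict A)) + ENNReal.ofReal (ℓ ^ (-s)) * (∫⁻ z in carlesonBox θ ℓ,
          ‖embedding (f n) z‖ₑ ^ p ∂(μ.restrict Aᶜ)) := by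
        rw [← mul_add, ← lintegral_add_measure, ← Measure.restrict_add,
          Measure.restrict_add_restrict_compl hAm]
    _ ≤ ε / 2 + ε / 2 := add_le_add h1 h2
    _ = ε := ENNReal.add_halves ε

theorem theorem2 (p s : ℝ) (hs : 0 < s) (hp : 0 < p) (hsp : 1 < s + p)
    (μ : Measure unitDisk) :
    (EmbeddingBounded p (p - 2) s μ ↔ IsLogCarleson p s μ) ∧
    (EmbeddingNullSequences p (p - 2) s μ → IsVanishingLogCarleson p s μ) ∧
    ((∀ K : Set unitDisk, IsCompact K → μ K < ∞) →
      IsVanishingLogCarleson p s μ → EmbeddingNullSequences p (p - 2) s μ) :=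
  ⟨⟨isLogCarleson_of_embeddingBounded hs hp hsp, embeddingBounded_of_isLogCarleson hs hp⟩,
    isVanishingLogCarleson_of_embeddingNullSequences hs hp hsp,
    embeddingNullSequences_of_isVanishingLogCarleson hs hp⟩
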